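/- **Setting.** Consider the coupled lattice system $$\omega z_n=(\Omega_1 z)_n+\gamma_n u_{0n},\qquad \omega u_{mn}=\gamma_n z_n\delta_{m0}+(\Omega_2u)_{mn}\qquad(m,n\in\mathbb Z),$$ where $-\Omega_2$ is the uniform discrete Laplacian on $\mathbb Z^2$, and $$(\Omega_1 z)_n=-\tfrac{k}{\sqrt{M_nM_{n+1}}}z_{n+1}+\tfrac{2k}{M_n}z_n-\tfrac{k}{\sqrt{M_nM_{n-1}}}z_{n-1}$$ is a chain with equal springs $k\in\mathbb R$. The masses $M_n>0$ and the real coupling constants $\gamma_n$ are $2$-periodic in $n$. Fix $M_0,M_1,k,\gamma_1$ and regard $\gamma_0$ as a parameter. For a Bloch wavenumber $\kappa$ and frequency $\omega$ put $\phi_j=(\kappa+ j)/2$ for $ j=0,1$, and define $\theta_j$ by $\omega=4-2\cos 2\pi\theta_j-2\cos2\pi\phi_j$, with $0\le\theta_j\le\frac12$ if $\theta_j$ is real (propagating harmonic) and $|e^{2\pi i\theta_j}|<1$ otherwise (evanescent harmonic). For fields $$z_n=\sum_j c_j e^{2\pi i\phi_j n},\qquad u_{mn}=\sum_j(a_j^+e^{2\pi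 i\theta_j m}+a_j^-e^{-2\pi i\theta_j m})e^{2\pi i\phi_j n}\ (m\le0),\qquad u_{mn}=\sum_j(b_j^+e^{2\pi i\theta_j m}+b_j^-e^{-2\pi i\theta_j m})e^{2\pi i\phi_j n}\ (m\ge0),$$ the system is equivalent to the six equations ($n=0,1$) $$\sum_j(a_j^--b_j^+)e^{\pi i j n}=\sum_j(b_j^--a_j^+)e^{\pi i j n},$$ $$\sum_j\big(a_j^-e^{2\pi i\theta_j}-b_j^+e^{-2\pi i\theta_j}-\gamma_nc_j\big)e^{\pi i j n}=\sum_j\big(b_j^-e^{2\pi i\theta_j}-a_j^+e^{-2\pi i\theta_j}\big)e^{\pi i j n},$$ $$\sum_j\Big(c_j\big(\omega-\tfrac{2k}{M_n}+\tfrac{2k\cos 2\pi\phi_j}{\sqrt{M_0M_1}}\big)-\gamma_nb_j^+\Big)e^{\pi i j n}=\gamma_n\sum_j b_j^-e^{\pi i j n}.$$ Write them, listed in any fixed order, as $\mathbb B X=F$ with $X=(a_0^-,a_1^-,b_0^+,b_1^+,c_0,c_1)$; here $\mathbb B=\mathbb B(\kappa,\omega,\gamma_0)$ is a $6\times6$ matrix,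 and $F=F(\kappa,\omega,\gamma_0)$ is the right-hand side for the incident plane wave $a_0^+=1$, $a_1^+=b_0^-=b_1^-=0$. Let $p^*=(0,\omega_0^*,\gamma_0^*)\in\mathbb R^3$ be a point in the regime of one propagating harmonic ($j=0$ propagating and $j=1$ evanescent, i.e. $0<\omega_0^*<4$), and suppose that $0$ is an algebraically simple eigenvalue of $\mathbb B(p^*)$. Let $\ell(\kappa,\omega,\gamma_0)$ be the (real-)analytic eigenvalue of $\mathbb B$ near $p^*$ with $\ell(p^*)=0$. Let $c\ne0$ be a complex constant and let $X(\kappa,\omega,\gamma_0)$ be the analytic solution, near $p^*$, of $\mathbb BX=c\,\ell F$. Let $a$ (reflected amplitude) and $b$ (transmitted amplitude) be its components $a_0^-$ and $b_0^+$. **Nondegeneracy.** Put $s(\kappa,\omega)=-2\sqrt{(2-\tfrac\omega2+\cos\pi\kappa)^2-1}$ and $$E_0=\Big(\omega-\tfrac{2k}{M_0}\Big)\gamma_1-\tfrac{2k\cos\pi\kappa}{\sqrt{M_0M_1}}\gamma_0-\tfrac{\gamma_0^2\gamma_1}{s},\qquad E_1=\tfrac{2k\cos\pi\kappa}{\sqrt{M_0M_1}}\gamma_1-\Big(\omega-\tfrac{2k}{M_1}\Big)\gamma_0+\tfrac{\gamma_0\gamma_1^2}{s}$$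 (the two real equations $E_0=E_1=0$ are the conditions for a guided mode, in which only the evanescent harmonic is excited). Assume that $\partial_\omega\ell$, $\partial_\omega a$, $\partial_\omega b$ do not vanish at $p^*$, and that at least one of the two Jacobian determinants $$\frac{\partial(\operatorname{Re}\ell,\operatorname{Im}\ell)}{\partial(\omega,\gamma_0)}(p^*),\qquad \frac{\partial(E_0,E_1)}{\partial(\omega,\gamma_0)}(p^*)$$ is nonzero. **Theorem.** There are open intervals $I=(-\delta,\delta)$, $J\ni\gamma_0^*$, $V\ni\omega_0^*$ and smooth functions $\omega_a,\omega_b:I\times J\to V$, $g:I\to J$, $W:I\to V$ such that * $a(\kappa,\omega_a(\kappa,\gamma_0),\gamma_0)=0$ and $b(\kappa,\omega_b(\kappa,\gamma_0),\gamma_0)=0$ for all $(\kappa,\gamma_0)\in I\times J$; * $\ell(\kappa_0,W(\kappa_0),g(\kappa_0))=0$ for all $\kappa_0\in I$, and these are all the zeros of $\ell$ in $I\times V\times J$; * $g(0)=\gamma_0^*$ and $W(0)=\omega_0^*$. Moreover, suppose that $g''(0)<0$ (resp. $g''(0)>0$), and that $\omega_a(\kappa,\gamma_0^*)<\omega_b(\kappa,\gamma_0^*)$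 for some $\kappa\in I$. Then: 1. For $\gamma_0=\gamma_0^*$, the only $\kappa_0\in I$ with $g(\kappa_0)=\gamma_0^*$ is $\kappa_0=0$. Furthermore $W(0)=\omega_a(0,\gamma_0^*)=\omega_b(0,\gamma_0^*)=\omega_0^*$, and $\omega_a(\kappa,\gamma_0^*)<\omega_b(\kappa,\gamma_0^*)$ for all $\kappa\in I\setminus\{0\}$. 2. For each $\gamma_0\in J$ with $\gamma_0<\gamma_0^*$ (resp. $\gamma_0>\gamma_0^*$), there is exactly one $\kappa_0>0$ in $I$ with $g(\kappa_0)=\gamma_0$, and $\pm\kappa_0$ are exactly the solutions of $g(\kappa)=\gamma_0$ in $I$. Furthermore $\omega_a(\pm\kappa_0,\gamma_0)=\omega_b(\pm\kappa_0,\gamma_0)=W(\pm\kappa_0)$, and $\omega_a(\kappa,\gamma_0)<\omega_b(\kappa,\gamma_0)$ for all $\kappa\in I\setminus\{\kappa_0,-\kappa_0\}$. 3. For each $\gamma_0\in J$ with $\gamma_0>\gamma_0^*$ (resp. $\gamma_0<\gamma_0^*$), there is no $\kappa_0\in I$ with $g(\kappa_0)=\gamma_0$, and $\omega_a(\kappa,\gamma_0)<\omega_b(\kappa,\gamma_0)$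 for all $\kappa\in I$. The same holds with "$<$" between $\omega_a$ and $\omega_b$ replaced by "$>$" throughout. -/

import Mathlib

open Set Filter Topology

noncomputable section

namespace PeriodTwoLattice

/-! The coupled system consists of a waveguide, i.e. a chain of beads with masses `M n`, springs
`K n` (joining bead `n` to bead `n + 1`), coupled to the uniform planar lattice along the line
`m = 0` by constants `γ n`, all `2`-periodic in `n` and hence indexed by `Fin 2`, with cyclic
arithmetic. The Bloch wavenumber is `κ`, the frequency is `ω`. -/

/-- The tangential wavenumber `φ_l = (κ + l) / 2` of the `l`-th Fourier harmonic. -/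
def phi (κ : ℝ) (l : Fin 2) : ℝ := (κ + (l : ℕ)) / 2

/-- The value that the dispersion relation `ω = 4 - 2 cos (2πθ_l) - 2 cos (2πφ_l)` assigns
to `cos (2πθ_l)`. -/
def cosTheta (κ ω : ℝ) (l : Fin 2) : ℝ := 2 - ω / 2 - Real.cos (2 * Real.pi * phi κ l)

/-- The normal wavenumber `θ_l`: a solution of the dispersion relation, nonnegative if it is real
(propagating harmonic) and with `exp (2πi θ_l m)` decaying as `m → ∞` otherwise (evanescent
harmonic). -/
def theta (κ ω : ℝ) (l : Fin 2) : ℂ :=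
  if |cosTheta κ ω l| ≤ 1 then ((Real.arccos (cosTheta κ ω l) / (2 * Real.pi) : ℝ) : ℂ)
  else if 1 < cosTheta κ ω l then
    Complex.I * ((Real.arcosh (cosTheta κ ω l) / (2 * Real.pi) : ℝ) : ℂ)
  else 1 / 2 + Complex.I * ((Real.arcosh (-cosTheta κ ω l) / (2 * Real.pi) : ℝ) : ℂ)

/-- The phase factor `exp (2πi θ_l)` of the `l`-th harmonic per lattice step in `m`. -/
def step (κ ω : ℝ) (l : Fin 2) : ℂ := Complex.exp (2 * Real.pi * Complex.I * theta κ ω l)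

/-- The factor `exp (2πi l n / 2)`. -/
def fourier (l n : Fin 2) : ℂ :=
  Complex.exp (2 * Real.pi * Complex.I * ((l : ℕ) : ℂ) * ((n : ℕ) : ℂ) / 2)

/-- The regime of one propagating harmonic, namely `l = 0`, the harmonic `l = 1` being
evanescent. -/
def OnePropagating (κ ω : ℝ) : Prop := |cosTheta κ ω 0| < 1 ∧ 1 < |cosTheta κ ω 1|

/-- The factor by which `ω - Ω₁` acts at site `n` on the `l`-th harmonic `exp (2πi φ_l n)`. -/
def waveguideSymbol (M K : Fin 2 → ℝ) (κ ω : ℝ) (n l : Fin 2) : ℂ :=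
  (ω : ℂ) - ((K n + K (n - 1)) / M n : ℝ)
    + (K n / Real.sqrt (M n * M (n + 1)) : ℝ) * Complex.exp (2 * Real.pi * Complex.I * phi κ l)
    + (K (n - 1) / Real.sqrt (M n * M (n - 1)) : ℝ)
        * Complex.exp (-(2 * Real.pi * Complex.I * phi κ l))

/-- The matrix of the scattering problem for a field
`u m n = ∑ l, (a⁺ l * exp (2πi θ_l m) + a⁻ l * exp (-2πi θ_l m)) * exp (2πi φ_l n)` for `m ≤ 0`,
`u m n = ∑ l, (b⁺ l * exp (2πi θ_l m) + b⁻ l * exp (-2πi θ_l m)) * exp (2πi φ_l n)` for `m ≥ 0`,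
`z n = ∑ l, c l * exp (2πi φ_l n)`.
Column `(0, l)` belongs to the unknown `a⁻ l`, column `(1, l)` to `b⁺ l` and column `(2, l)` to
`c l`. Row `(0, n)` is continuity at `(0, n)`, row `(1, n)` is the equation of motion of the
planar lattice at `(0, n)`, row `(2, n)` is the equation of motion of the waveguide at `n`. -/
def scatteringMatrix (M K γ : Fin 2 → ℝ) (κ ω : ℝ) :
    Matrix (Fin 3 × Fin 2) (Fin 3 × Fin 2) ℂ := fun r s =>
  (!![1, -1, 0;
      step κ ω s.2, -(step κ ω s.2)⁻¹, -(γ r.2 : ℂ);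
      0, -(γ r.2 : ℂ), waveguideSymbol M K κ ω r.2 s.2] : Matrix (Fin 3) (Fin 3) ℂ) r.1 s.1
    * fourier s.2 r.2

/-- The right-hand side of the scattering problem for incoming amplitudes `a⁺` from the left and
`b⁻` from the right. -/
def sourceVector (γ : Fin 2 → ℝ) (κ ω : ℝ) (aPlus bMinus : Fin 2 → ℂ) : Fin 3 × Fin 2 → ℂ :=
  fun r => ∑ l : Fin 2,
    ![bMinus l - aPlus l,
      bMinus l * step κ ω l - aPlus l * (step κ ω l)⁻¹,
      (γ r.2 : ℂ) * bMinus l] r.1 * fourier l r.2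

/-- The scattering matrix with its equations listed in the order `σ`, as a function of the
wavenumber, the frequency and the coupling constant `γ₀`, for equal springs. -/
def matB (M : Fin 2 → ℝ) (k γ₁ : ℝ) (σ : Equiv.Perm (Fin 3 × Fin 2)) (p : ℝ × ℝ × ℝ) :
    Matrix (Fin 3 × Fin 2) (Fin 3 × Fin 2) ℂ :=
  (scatteringMatrix M (fun _ => k) ![p.2.2, γ₁] p.1 p.2.1).submatrix σ id

/-- The corresponding source vector for the plane wave `exp (2πi (θ_0 m + φ_0 n))` incident from
the left. -/
def vecF (γ₁ : ℝ) (σ : Equiv.Perm (Fin 3 × Fin 2)) (p : ℝ × ℝ × ℝ) : Fin 3 × Fin 2 → ℂ :=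
  sourceVector ![p.2.2, γ₁] p.1 p.2.1 (Pi.single 0 1) 0 ∘ σ

/-- `ev` is the analytic branch, near the point `q`, of the eigenvalue of `B` that vanishes
at `q`; zero is an (algebraically) simple eigenvalue of `B q`. -/
structure IsZeroEigenvalueBranch {ι : Type} [Fintype ι] [DecidableEq ι]
    (B : ℝ × ℝ × ℝ → Matrix ι ι ℂ) (ev : ℝ × ℝ × ℝ → ℂ) (q : ℝ × ℝ × ℝ) : Prop where
  analyticAt : AnalyticAt ℝ ev q
  mem_spectrum : ∀ᶠ p in 𝓝 q, ev p ∈ spectrum ℂ (B p)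
  eq_zero : ev q = 0
  simple : (B q).charpoly.rootMultiplicity 0 = 1

/-- `X` is the analytic family, near `q`, of solutions of the scattering problem for the source
`F` scaled by `c * ev`. -/
structure IsConnectingField {ι : Type} [Fintype ι]
    (B : ℝ × ℝ × ℝ → Matrix ι ι ℂ) (F : ℝ × ℝ × ℝ → ι → ℂ) (c : ℂ) (ev : ℝ × ℝ × ℝ → ℂ)
    (X : ℝ × ℝ × ℝ → ι → ℂ) (q : ℝ × ℝ × ℝ) : Prop where
  analyticAt : AnalyticAt ℝ X q
  solves : ∀ᶠ p in 𝓝 q, (B p).mulVec (X p) = (c * ev p) • F p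

/-- Partial derivative with respect to the frequency. -/
def dOmega {E : Type} [NormedAddCommGroup E] [NormedSpace ℝ E] (f : ℝ × ℝ × ℝ → E)
    (q : ℝ × ℝ × ℝ) : E := deriv (fun ω => f (q.1, ω, q.2.2)) q.2.1

/-- Partial derivative with respect to the coupling constant `γ₀`. -/
def dGamma {E : Type} [NormedAddCommGroup E] [NormedSpace ℝ E] (f : ℝ × ℝ × ℝ → E)
    (q : ℝ × ℝ × ℝ) : E := deriv (fun γ₀ => f (q.1, q.2.1, γ₀)) q.2.2

/-- The Jacobian determinant of the pair `(f, h)` with respect to `(ω, γ₀)`. -/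
def jacobian (f h : ℝ × ℝ × ℝ → ℝ) (q : ℝ × ℝ × ℝ) : ℝ :=
  dOmega f q * dGamma h q - dGamma f q * dOmega h q

/-- `2i sin (2πθ_1)` for the evanescent harmonic. -/
def evanescentFactor (κ ω : ℝ) : ℝ :=
  -2 * Real.sqrt ((2 - ω / 2 + Real.cos (Real.pi * κ)) ^ 2 - 1)

/-- The residual of the waveguide equation at site `0`, for the field
`z 0 = γ₁`, `z 1 * exp (-πi κ) = -γ₀` (values at `n = 0, 1`) for which the propagating harmonic is
not excited and the evanescent one has amplitude `γ₀ γ₁ / (2i sin (2πθ_1))`. Up to scaling, a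
guided mode is such a field with both residuals equal to zero. -/
def residual₀ (M : Fin 2 → ℝ) (k γ₁ : ℝ) (p : ℝ × ℝ × ℝ) : ℝ :=
  (p.2.1 - 2 * k / M 0) * γ₁
    - 2 * k * Real.cos (Real.pi * p.1) / Real.sqrt (M 0 * M 1) * p.2.2
    - p.2.2 ^ 2 * γ₁ / evanescentFactor p.1 p.2.1

/-- The residual of the waveguide equation at site `1` for the same field. -/
def residual₁ (M : Fin 2 → ℝ) (k γ₁ : ℝ) (p : ℝ × ℝ × ℝ) : ℝ :=
  2 * k * Real.cos (Real.pi * p.1) / Real.sqrt (M 0 * M 1) * γ₁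
    - (p.2.1 - 2 * k / M 1) * p.2.2
    + p.2.2 * γ₁ ^ 2 / evanescentFactor p.1 p.2.1

/-- The bifurcation picture on the intervals `I`, `J`, with `R` the order of the two frequencies
`ωa`, `ωb` away from the guided modes, and `S` the side of `γs` on which there are two modes. -/
structure Bifurcates (I J : Set ℝ) (ωs γs : ℝ) (ωa ωb : ℝ → ℝ → ℝ) (g W : ℝ → ℝ)
    (R S : ℝ → ℝ → Prop) : Prop where
  critical_unique : ∀ κ ∈ I, g κ = γs ↔ κ = 0
  critical_values : W 0 = ωs ∧ ωa 0 γs = ωs ∧ ωb 0 γs = ωs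
  critical_order : ∀ κ ∈ I, κ ≠ 0 → R (ωa κ γs) (ωb κ γs)
  two_modes : ∀ γ₀ ∈ J, S γ₀ γs → ∃ κ₀ ∈ I, 0 < κ₀ ∧ -κ₀ ∈ I ∧
    (∀ κ ∈ I, g κ = γ₀ ↔ κ = κ₀ ∨ κ = -κ₀) ∧
    (ωa κ₀ γ₀ = W κ₀ ∧ ωb κ₀ γ₀ = W κ₀) ∧
    (ωa (-κ₀) γ₀ = W (-κ₀) ∧ ωb (-κ₀) γ₀ = W (-κ₀)) ∧
    (∀ κ ∈ I, κ ≠ κ₀ → κ ≠ -κ₀ → R (ωa κ γ₀) (ωb κ γ₀))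
  no_modes : ∀ γ₀ ∈ J, S γs γ₀ →
    (∀ κ ∈ I, g κ ≠ γ₀) ∧ ∀ κ ∈ I, R (ωa κ γ₀) (ωb κ γ₀)

end PeriodTwoLattice

end

/-!
Continuity across the line `m = 0` and elimination of the evanescent harmonic reduce the
scattering problem to the values `z = (z₀, z₁)` of the field at the two waveguide sites. With
`γ = (γ₀, γ₁)`, a real symmetric `2 × 2` matrix `S` (entries `site₀₀`, `site₀₁`, `site₁₁`) and
`s = sin (2πθ_0) > 0`, the amplitudes `a`, `b` and the incident amplitude `L = c ℓ` satisfy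
`S z = b γ`, `γ ⬝ z = 4 i s a` and `b = a + L` (`exists_site_values`). Put `D = det S` (`siteDet`)
and `Q = γ ⬝ adj S γ` (`siteForm`). Then `χ = 4 i s D - Q` (`characteristic`) satisfies
`χ a = Q L` and `χ b = 4 i s D L`, and `L = 0` forces `a = b = 0` because `S` is real symmetric
(`amplitudes_of_solves`). As `Q` and `D` are real, `χ = 0` means `Q = D = 0`. The determinant of
the scattering matrix is a nonvanishing multiple of `χ` (`det_scatteringMatrix`), and so is, near a
point where it vanishes and zero is a simple eigenvalue, the eigenvalue `ℓ`
(`IsZeroEigenvalueBranch.exists_eq_mul_det`). Hence `a` vanishes where `Q` does, `b` where `D` does,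
and `ℓ` where both do, and the frequencies `ωa`, `ωb` are the real implicit functions of `Q = 0` and
`D = 0`.

Let `E = S (γ₁, -γ₀)` be the vector of the two residuals. Writing `S` in the orthogonal basis
`γ`, `(γ₁, -γ₀)` gives `|γ|⁴ D = (γ ⬝ S γ) Q - (γ ⬝ E)²` (`siteDet_identity`), while `Q` is the
product of `E` with `(γ₁, -γ₀)`. This identity carries the rest of the argument.

* `Q = D = 0` is equivalent to `E = 0`, so the zeros of `ℓ` are those of the residuals.
* At a guided mode `dD` is a multiple of `dQ`, so that the Jacobian of `(Re ℓ, Im ℓ)` always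
  vanishes (`jacobian_re_im_eq_zero`) and that of the residuals does not; the implicit function
  theorem then yields `g` and `W`.
* Where `Q = 0`, `D ≤ 0`, with equality exactly at the guided modes. Since `D` is monotone in `ω`,
  its value at `ωa` decides on which side of `ωb` this frequency lies; thus `ωa - ωb` has one sign
  on `I × J` and vanishes exactly over the graph of `g`.

Finally the residuals are even in `κ`, so `g` is even, and if `g'' 0 ≠ 0` it is strictly monotone on
`[0, δ)`; taking `g δ` as an endpoint of `J` makes every `γ₀` on the relevant side of the critical
value be attained exactly twice (`exists_bifurcation_intervals`, `Bifurcates.of_graph`).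
-/

namespace PeriodTwoLattice

/-! ### Partial derivatives -/

lemma dOmega_eq_fderiv {E : Type} [NormedAddCommGroup E] [NormedSpace ℝ E] {f : ℝ × ℝ × ℝ → E}
    {q : ℝ × ℝ × ℝ} (hf : DifferentiableAt ℝ f q) :
    dOmega f q = fderiv ℝ f q (0, 1, 0) := by
  have h : HasDerivAt (fun ω : ℝ => (q.1, ω, q.2.2)) ((0, 1, 0) : ℝ × ℝ × ℝ) q.2.1 :=
    (hasDerivAt_const _ _).prodMk ((hasDerivAt_id _).prodMk (hasDerivAt_const _ _))
  exact (HasFDerivAt.comp_hasDerivAt q.2.1 hf.hasFDerivAt h).deriv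

lemma dGamma_eq_fderiv {E : Type} [NormedAddCommGroup E] [NormedSpace ℝ E] {f : ℝ × ℝ × ℝ → E}
    {q : ℝ × ℝ × ℝ} (hf : DifferentiableAt ℝ f q) :
    dGamma f q = fderiv ℝ f q (0, 0, 1) := by
  have h : HasDerivAt (fun γ : ℝ => (q.1, q.2.1, γ)) ((0, 0, 1) : ℝ × ℝ × ℝ) q.2.2 :=
    (hasDerivAt_const _ _).prodMk ((hasDerivAt_const _ _).prodMk (hasDerivAt_id _))
  exact (HasFDerivAt.comp_hasDerivAt q.2.2 hf.hasFDerivAt h).deriv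

lemma hasDerivAt_dOmega {E : Type} [NormedAddCommGroup E] [NormedSpace ℝ E] {f : ℝ × ℝ × ℝ → E}
    {q : ℝ × ℝ × ℝ} (hf : DifferentiableAt ℝ f q) :
    HasDerivAt (fun ω => f (q.1, ω, q.2.2)) (dOmega f q) q.2.1 := by
  have h : HasDerivAt (fun ω : ℝ => (q.1, ω, q.2.2)) ((0, 1, 0) : ℝ × ℝ × ℝ) q.2.1 :=
    (hasDerivAt_const _ _).prodMk ((hasDerivAt_id _).prodMk (hasDerivAt_const _ _))
  rw [dOmega_eq_fderiv hf]
  exact HasFDerivAt.comp_hasDerivAt q.2.1 hf.hasFDerivAt h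

lemma hasDerivAt_dGamma {E : Type} [NormedAddCommGroup E] [NormedSpace ℝ E] {f : ℝ × ℝ × ℝ → E}
    {q : ℝ × ℝ × ℝ} (hf : DifferentiableAt ℝ f q) :
    HasDerivAt (fun γ => f (q.1, q.2.1, γ)) (dGamma f q) q.2.2 := by
  have h : HasDerivAt (fun γ : ℝ => (q.1, q.2.1, γ)) ((0, 0, 1) : ℝ × ℝ × ℝ) q.2.2 :=
    (hasDerivAt_const _ _).prodMk ((hasDerivAt_const _ _).prodMk (hasDerivAt_id _))
  rw [dGamma_eq_fderiv hf]
  exact HasFDerivAt.comp_hasDerivAt q.2.2 hf.hasFDerivAt h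

/-! ### Implicit functions -/

/-- The implicit function theorem in the analytic class. Analyticity makes the implicit function
smooth on a whole neighbourhood of the base point. -/
lemma exists_analytic_implicit {P Y : Type*} [NormedAddCommGroup P] [NormedSpace ℝ P]
    [CompleteSpace P] [NormedAddCommGroup Y] [NormedSpace ℝ Y] [FiniteDimensional ℝ Y]
    (f : P × Y → Y) (u : P × Y) (hf : ContDiffAt ℝ ⊤ f u) (hu : f u = 0)
    (hinj : ∀ y, fderiv ℝ f u (0, y) = 0 → y = 0) :
    ∃ ψ : P → Y, ψ u.1 = u.2 ∧ (∀ᶠ x in 𝓝 u.1, ContDiffAt ℝ ⊤ ψ x) ∧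
      ∀ᶠ p in 𝓝 u, f p = 0 ↔ ψ p.1 = p.2 := by
  have : CompleteSpace Y := FiniteDimensional.complete ℝ Y
  have hinv : (fderiv ℝ f u ∘L .inr ℝ P Y).IsInvertible := by
    set A := fderiv ℝ f u ∘L .inr ℝ P Y with hA
    have hi : Function.Injective (A : Y →ₗ[ℝ] Y) := by
      rw [injective_iff_map_eq_zero]
      intro y hy
      exact hinj y (by simpa [hA] using hy)
    refine ⟨(LinearEquiv.ofInjectiveEndo (A : Y →ₗ[ℝ] Y) hi).toContinuousLinearEquiv, ?_⟩
    ext y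
    rfl
  refine ⟨hf.implicitFunction (by simp) hinv, hf.implicitFunction_apply_self (by simp) hinv,
    (hf.contDiffAt_implicitFunction (by simp) hinv).eventually (by simp), ?_⟩
  simpa [hu] using hf.eventually_apply_eq_iff_implicitFunction (by simp) hinv

/-- A smooth real equation `f (κ, ω, γ) = 0` can be solved for `ω`. -/
lemma exists_implicit_frequency {f : ℝ × ℝ × ℝ → ℝ} {q : ℝ × ℝ × ℝ} (hf : ContDiffAt ℝ ⊤ f q)
    (h0 : f q = 0) (h1 : dOmega f q ≠ 0) :
    ∃ ψ : ℝ × ℝ → ℝ, ψ (q.1, q.2.2) = q.2.1 ∧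
      (∀ᶠ x in 𝓝 (q.1, q.2.2), ContDiffAt ℝ ⊤ ψ x) ∧
      ∀ᶠ p in 𝓝 q, f p = 0 ↔ ψ (p.1, p.2.2) = p.2.1 := by
  set e : (ℝ × ℝ) × ℝ → ℝ × ℝ × ℝ := fun x => (x.1.1, x.2, x.1.2) with he
  set u : (ℝ × ℝ) × ℝ := ((q.1, q.2.2), q.2.1) with hu
  have hd : DifferentiableAt ℝ f q := hf.differentiableAt (by simp)
  have hfe : ContDiffAt ℝ ⊤ (f ∘ e) u :=
    ContDiffAt.comp u hf (by rw [he]; fun_prop)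
  have hder : ∀ y : ℝ, fderiv ℝ (f ∘ e) u (0, y) = y * dOmega f q := by
    intro y
    have h2 : HasDerivAt (fun ω : ℝ => ((q.1, q.2.2), ω)) (((0, 0), 1) : (ℝ × ℝ) × ℝ) q.2.1 :=
      (hasDerivAt_const _ _).prodMk (hasDerivAt_id _)
    have h3 := HasFDerivAt.comp_hasDerivAt q.2.1
      (hfe.differentiableAt (by simp)).hasFDerivAt h2
    have h4 := h3.unique (hasDerivAt_dOmega hd)
    have h5 : ((0, y) : (ℝ × ℝ) × ℝ) = y • ((0, 0), 1) := by ext <;> simp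
    rw [h5, map_smul, h4, smul_eq_mul]
  obtain ⟨ψ, hψ0, hψ1, hψ2⟩ := exists_analytic_implicit (f ∘ e) u hfe h0 (fun y hy => by
    rw [hder] at hy
    exact (mul_eq_zero.mp hy).resolve_right h1)
  refine ⟨ψ, hψ0, hψ1, ?_⟩
  have hc : Tendsto (fun p : ℝ × ℝ × ℝ => ((p.1, p.2.2), p.2.1)) (𝓝 q) (𝓝 u) := by
    apply Continuous.tendsto
    fun_prop
  exact hc.eventually hψ2

/-- A pair of smooth real equations in `(κ, ω, γ)` can be solved for `(ω, γ)`. -/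
lemma exists_implicit_pair {f h : ℝ × ℝ × ℝ → ℝ} {q : ℝ × ℝ × ℝ} (hf : ContDiffAt ℝ ⊤ f q)
    (hh : ContDiffAt ℝ ⊤ h q) (hf0 : f q = 0) (hh0 : h q = 0) (hj : jacobian f h q ≠ 0) :
    ∃ ψ : ℝ → ℝ × ℝ, ψ q.1 = q.2 ∧ (∀ᶠ x in 𝓝 q.1, ContDiffAt ℝ ⊤ ψ x) ∧
      ∀ᶠ p in 𝓝 q, (f p = 0 ∧ h p = 0) ↔ ψ p.1 = p.2 := by
  have hdf : DifferentiableAt ℝ f q := hf.differentiableAt (by simp)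
  have hdh : DifferentiableAt ℝ h q := hh.differentiableAt (by simp)
  have key : ∀ (y : ℝ × ℝ) (φ : ℝ × ℝ × ℝ → ℝ), DifferentiableAt ℝ φ q →
      fderiv ℝ φ q (0, y) = y.1 * dOmega φ q + y.2 * dGamma φ q := by
    intro y φ hφ
    have : ((0, y) : ℝ × ℝ × ℝ) = y.1 • (0, 1, 0) + y.2 • (0, 0, 1) := by
      ext <;> simp
    rw [this, map_add, map_smul, map_smul, dOmega_eq_fderiv hφ, dGamma_eq_fderiv hφ]
    simp
  obtain ⟨ψ, h0, h1, h2⟩ := exists_analytic_implicit (fun p => (f p, h p)) q (hf.prodMk hh)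
    (by simp [hf0, hh0]) (fun y hy => by
      rw [(hdf.hasFDerivAt.prodMk hdh.hasFDerivAt).fderiv, ContinuousLinearMap.prod_apply,
        key y f hdf, key y h hdh, Prod.mk_eq_zero] at hy
      unfold jacobian at hj
      obtain ⟨e1, e2⟩ := hy
      have a1 : y.1 * (dOmega f q * dGamma h q - dGamma f q * dOmega h q) = 0 := by
        linear_combination dGamma h q * e1 - dGamma f q * e2
      have a2 : y.2 * (dOmega f q * dGamma h q - dGamma f q * dOmega h q) = 0 := by
        linear_combination dOmega f q * e2 - dOmega h q * e1
      exact Prod.ext ((mul_eq_zero.mp a1).resolve_right hj) ((mul_eq_zero.mp a2).resolve_right hj))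
  exact ⟨ψ, h0, h1, by simpa [Prod.mk_eq_zero] using h2⟩

/-! ### Even functions with nondegenerate critical point -/

/-- A function that is even near `0` and has negative second derivative there decreases strictly
to the right of `0`. -/
lemma exists_strictAntiOn_of_even {g : ℝ → ℝ} (hg : ContDiffAt ℝ ⊤ g 0)
    (heven : ∀ᶠ x in 𝓝 (0 : ℝ), g (-x) = g x) (h2 : deriv (deriv g) 0 < 0) :
    ∃ ε > 0, StrictAntiOn g (Icc 0 ε) := by
  have hd0 : deriv g 0 = 0 := by
    have h1 : deriv (fun x => g (-x)) 0 = deriv g 0 := EventuallyEq.deriv_eq heven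
    rw [deriv_comp_neg, neg_zero] at h1
    linarith
  have hdd : HasDerivAt (deriv g) (deriv (deriv g) 0) 0 :=
    DifferentiableAt.hasDerivAt (by
      by_contra hnd
      rw [deriv_zero_of_not_differentiableAt hnd] at h2
      exact lt_irrefl _ h2)
  have hneg : ∀ᶠ x in 𝓝[>] (0 : ℝ), deriv g x < 0 := by
    have := (hasDerivAt_iff_tendsto_slope.mp hdd).mono_left
      (nhdsWithin_mono (0 : ℝ) (fun x (hx : 0 < x) => hx.ne'))
    filter_upwards [this.eventually_lt_const h2, self_mem_nhdsWithin] with x hx hx0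
    rw [slope_def_field, hd0, sub_zero, sub_zero] at hx
    have hx0' : 0 < x := hx0
    by_contra hcon
    exact absurd (div_nonneg (not_lt.mp hcon) hx0'.le) (not_le.mpr hx)
  have hcont : ∀ᶠ x in 𝓝 (0 : ℝ), ContinuousAt g x :=
    (hg.eventually (by simp)).mono fun x hx => hx.continuousAt
  obtain ⟨ε₁, hε₁, H₁⟩ := mem_nhdsGT_iff_exists_Ioo_subset.mp hneg
  obtain ⟨ε₂, hε₂, H₂⟩ := Metric.eventually_nhds_iff.mp hcont
  have hε₁' : 0 < ε₁ := hε₁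
  refine ⟨min ε₁ ε₂ / 2, by positivity, ?_⟩
  have hlt1 : min ε₁ ε₂ / 2 < ε₁ := by
    have := min_le_left ε₁ ε₂
    linarith
  have hlt2 : min ε₁ ε₂ / 2 < ε₂ := by
    have := min_le_right ε₁ ε₂
    linarith
  refine strictAntiOn_of_deriv_neg (convex_Icc _ _) ?_ ?_
  · intro x hx
    refine (H₂ ?_).continuousWithinAt
    rw [Real.dist_eq, sub_zero, abs_of_nonneg hx.1]
    exact hx.2.trans_lt hlt2
  · intro x hx
    rw [interior_Icc] at hx
    exact H₁ ⟨hx.1, hx.2.trans hlt1⟩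

/-- An even `g` with `g'' 0 < 0` decreases on `[0, δ)` and takes there every value between `g δ`
and `g 0`, for some `δ` below any given bound. -/
lemma exists_interval_of_anti {g : ℝ → ℝ} {δ₀ : ℝ} (hδ₀ : 0 < δ₀)
    (hg : ∀ x ∈ Ioo (-δ₀) δ₀, ContDiffAt ℝ ⊤ g x)
    (heven : ∀ x ∈ Ioo (-δ₀) δ₀, g (-x) = g x) (h2 : deriv (deriv g) 0 < 0) :
    ∃ δ, 0 < δ ∧ δ < δ₀ ∧ g δ < g 0 ∧ (∀ x ∈ Ioo (-δ) δ, g δ < g x ∧ g x ≤ g 0) ∧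
      (∀ x y, 0 ≤ x → x < y → y < δ → g y < g x) ∧
      ∀ c, g δ < c → c < g 0 → ∃ x ∈ Ioo 0 δ, g x = c := by
  have h0 : (0 : ℝ) ∈ Ioo (-δ₀) δ₀ := ⟨by linarith, hδ₀⟩
  obtain ⟨ε, hε, hanti⟩ := exists_strictAntiOn_of_even (hg 0 h0)
    (Filter.eventually_of_mem (Ioo_mem_nhds h0.1 h0.2) heven) h2
  obtain ⟨δ, hδ, hδ'⟩ := exists_between (lt_min hε hδ₀)
  have hδε : δ < ε := hδ'.trans_le (min_le_left _ _)
  have hδδ : δ < δ₀ := hδ'.trans_le (min_le_right _ _)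
  have hmono : ∀ x y, 0 ≤ x → x < y → y ≤ δ → g y < g x := fun x y hx hxy hy =>
    hanti ⟨hx, by linarith⟩ ⟨by linarith, by linarith⟩ hxy
  have hpos : ∀ x, 0 ≤ x → x < δ → g δ < g x ∧ g x ≤ g 0 := by
    intro x hx hxδ
    refine ⟨hmono x δ hx hxδ le_rfl, ?_⟩
    rcases hx.eq_or_lt with rfl | hx'
    · exact le_rfl
    · exact (hmono 0 x le_rfl hx' hxδ.le).le
  refine ⟨δ, hδ, hδδ, hmono 0 δ le_rfl hδ le_rfl, ?_,
    fun x y hx hxy hy => hmono x y hx hxy hy.le, ?_⟩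
  · intro x hx
    rcases le_total 0 x with h | h
    · exact hpos x h hx.2
    · rw [← heven x ⟨by linarith [hx.1], by linarith [hx.2]⟩]
      exact hpos (-x) (by linarith) (by linarith [hx.1])
  · intro c hc1 hc2
    have hcont : ContinuousOn g (Icc 0 δ) := fun x hx =>
      (hg x ⟨by linarith [hx.1], by linarith [hx.2]⟩).continuousAt.continuousWithinAt
    obtain ⟨x, hx, hxc⟩ := intermediate_value_Ioo' hδ.le hcont ⟨hc1, hc2⟩
    exact ⟨x, hx, hxc⟩

/-- Intervals adapted to the bifurcation: `g` maps `I = (-δ, δ)` into `J = (j₁, j₂)`, and if its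
second derivative at `0` does not vanish it is monotone on `[0, δ)` and takes there every value of
`J` on the corresponding side of `g 0`. -/
lemma exists_bifurcation_intervals {g : ℝ → ℝ} {δ₀ η : ℝ} (hδ₀ : 0 < δ₀)
    (hg : ∀ x ∈ Ioo (-δ₀) δ₀, ContDiffAt ℝ ⊤ g x)
    (heven : ∀ x ∈ Ioo (-δ₀) δ₀, g (-x) = g x)
    (hmaps : ∀ x ∈ Ioo (-δ₀) δ₀, g x ∈ Ioo (g 0 - η) (g 0 + η)) :
    ∃ δ j₁ j₂, 0 < δ ∧ δ ≤ δ₀ ∧ g 0 ∈ Ioo j₁ j₂ ∧ Ioo j₁ j₂ ⊆ Ioo (g 0 - η) (g 0 + η) ∧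
      (∀ x ∈ Ioo (-δ) δ, g x ∈ Ioo j₁ j₂) ∧
      (deriv (deriv g) 0 < 0 → (∀ x y, 0 ≤ x → x < y → y < δ → g y < g x) ∧
        ∀ c ∈ Ioo j₁ j₂, c < g 0 → ∃ x ∈ Ioo 0 δ, g x = c) ∧
      (deriv (deriv g) 0 > 0 → (∀ x y, 0 ≤ x → x < y → y < δ → g y > g x) ∧
        ∀ c ∈ Ioo j₁ j₂, c > g 0 → ∃ x ∈ Ioo 0 δ, g x = c) := by
  have hη : 0 < η := by
    have := hmaps 0 ⟨by linarith, hδ₀⟩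
    linarith [this.1]
  rcases lt_trichotomy (deriv (deriv g) 0) 0 with h2 | h2 | h2
  · obtain ⟨δ, hδ, hδδ, hlt, hm, hmono, hsurj⟩ := exists_interval_of_anti hδ₀ hg heven h2
    have hδm := hmaps δ ⟨by linarith, hδδ⟩
    refine ⟨δ, g δ, g 0 + η, hδ, hδδ.le, ⟨hlt, by linarith⟩, Ioo_subset_Ioo hδm.1.le le_rfl,
      fun x hx => ⟨(hm x hx).1, by linarith [(hm x hx).2]⟩,
      fun _ => ⟨hmono, fun c hc hc' => hsurj c hc.1 hc'⟩, fun h => absurd h (not_lt.mpr h2.le)⟩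
  · exact ⟨δ₀, g 0 - η, g 0 + η, hδ₀, le_rfl, ⟨by linarith, by linarith⟩, Subset.rfl, hmaps,
      fun h => absurd h (by rw [h2]; exact lt_irrefl _),
      fun h => absurd h (by rw [h2]; exact lt_irrefl _)⟩
  · have h2' : deriv (deriv (fun x => -g x)) 0 < 0 := by
      have : deriv (fun x => -g x) = fun x => -deriv g x := by
        ext x
        exact deriv.fun_neg
      rw [this, deriv.fun_neg]
      linarith
    obtain ⟨δ, hδ, hδδ, hlt, hm, hmono, hsurj⟩ := exists_interval_of_anti (g := fun x => -g x) hδ₀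
      (fun x hx => (hg x hx).neg) (fun x hx => by rw [heven x hx]) h2'
    have hδm := hmaps δ ⟨by linarith, hδδ⟩
    refine ⟨δ, g 0 - η, g δ, hδ, hδδ.le, ⟨by linarith, by linarith⟩,
      Ioo_subset_Ioo le_rfl hδm.2.le,
      fun x hx => ⟨by linarith [(hm x hx).2], by linarith [(hm x hx).1]⟩,
      fun h => absurd h (not_lt.mpr h2.le),
      fun _ => ⟨fun x y hx hxy hy => by linarith [hmono x y hx hxy hy], fun c hc hc' => ?_⟩⟩
    obtain ⟨x, hx, hxc⟩ := hsurj (-c) (by linarith [hc.2]) (by linarith)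
    exact ⟨x, hx, by linarith⟩

/-- The bifurcation picture, once `ωa` and `ωb` are known to meet exactly over the graph of an even
function `g` that is strictly monotone on the right half of `I`. -/
lemma Bifurcates.of_graph {δ : ℝ} {J : Set ℝ} {ωs γs : ℝ} {ωa ωb : ℝ → ℝ → ℝ} {g W : ℝ → ℝ}
    {R S : ℝ → ℝ → Prop} (hδ : 0 < δ) (hS : ∀ x y, S x y → ¬ S y x) (hγs : γs ∈ J)
    (hg0 : g 0 = γs) (hW0 : W 0 = ωs)
    (heven : ∀ κ ∈ Ioo (-δ) δ, g (-κ) = g κ)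
    (hmono : ∀ x y, 0 ≤ x → x < y → y < δ → S (g y) (g x))
    (hsurj : ∀ c ∈ J, S c γs → ∃ x ∈ Ioo 0 δ, g x = c)
    (hmeet : ∀ κ ∈ Ioo (-δ) δ, ∀ γ ∈ J, γ = g κ → ωa κ γ = W κ ∧ ωb κ γ = W κ)
    (hapart : ∀ κ ∈ Ioo (-δ) δ, ∀ γ ∈ J, γ ≠ g κ → R (ωa κ γ) (ωb κ γ)) :
    Bifurcates (Ioo (-δ) δ) J ωs γs ωa ωb g W R S := by
  have hirr : ∀ x, ¬ S x x := fun x h => hS x x h h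
  have h0 : (0 : ℝ) ∈ Ioo (-δ) δ := ⟨by linarith, hδ⟩
  have habs : ∀ κ ∈ Ioo (-δ) δ, g |κ| = g κ := by
    intro κ hκ
    rcases abs_choice κ with h | h <;> rw [h]
    exact heven κ hκ
  have hside : ∀ κ ∈ Ioo (-δ) δ, κ ≠ 0 → S (g κ) γs := by
    intro κ hκ hne
    rw [← habs κ hκ, ← hg0]
    exact hmono 0 |κ| le_rfl (abs_pos.mpr hne) (abs_lt.mpr hκ)
  have hcrit : ∀ κ ∈ Ioo (-δ) δ, g κ = γs ↔ κ = 0 := by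
    intro κ hκ
    refine ⟨fun h => ?_, fun h => by rw [h, hg0]⟩
    by_contra hne
    have := hside κ hκ hne
    rw [h] at this
    exact hirr _ this
  refine ⟨hcrit, ?_, ?_, ?_, ?_⟩
  · have := hmeet 0 h0 γs hγs hg0.symm
    exact ⟨hW0, by rw [this.1, hW0], by rw [this.2, hW0]⟩
  · intro κ hκ hne
    exact hapart κ hκ γs hγs fun h => hne ((hcrit κ hκ).mp h.symm)
  · intro γ hγ hSγ
    obtain ⟨κ₀, hκ₀, hgκ₀⟩ := hsurj γ hγ hSγ
    have hp : κ₀ ∈ Ioo (-δ) δ := ⟨by linarith [hκ₀.1], hκ₀.2⟩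
    have hm : -κ₀ ∈ Ioo (-δ) δ := ⟨by linarith [hκ₀.2], by linarith [hκ₀.1]⟩
    have hgm : g (-κ₀) = γ := by rw [heven κ₀ hp, hgκ₀]
    have hiff : ∀ κ ∈ Ioo (-δ) δ, g κ = γ ↔ κ = κ₀ ∨ κ = -κ₀ := by
      intro κ hκ
      constructor
      · intro h
        rw [← abs_eq hκ₀.1.le]
        have hlt : |κ| < δ := abs_lt.mpr hκ
        have heq : g |κ| = g κ₀ := by rw [habs κ hκ, h, hgκ₀]
        rcases lt_trichotomy |κ| κ₀ with hc | hc | hc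
        · have := hmono _ _ (abs_nonneg κ) hc hκ₀.2
          rw [heq] at this
          exact absurd this (hirr _)
        · exact hc
        · have := hmono _ _ hκ₀.1.le hc hlt
          rw [heq] at this
          exact absurd this (hirr _)
      · rintro (rfl | rfl)
        · exact hgκ₀
        · exact hgm
    exact ⟨κ₀, hp, hκ₀.1, hm, hiff, hmeet κ₀ hp γ hγ hgκ₀.symm, hmeet (-κ₀) hm γ hγ hgm.symm,
      fun κ hκ h1 h2 => hapart κ hκ γ hγ fun h =>
        ((hiff κ hκ).mp h.symm).elim h1 h2⟩
  · intro γ hγ hSγ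
    have hne : ∀ κ ∈ Ioo (-δ) δ, g κ ≠ γ := by
      intro κ hκ h
      by_cases hκ0 : κ = 0
      · rw [hκ0, hg0] at h
        rw [h] at hSγ
        exact hirr _ hSγ
      · have := hside κ hκ hκ0
        rw [h] at this
        exact hS _ _ hSγ this
    exact ⟨hne, fun κ hκ => hapart κ hκ γ hγ fun h => hne κ hκ h.symm⟩

/-! ### Roots near the critical point -/

lemma exists_box {H : ℝ × ℝ × ℝ → Prop} {κs ωs γs : ℝ} (h : ∀ᶠ p in 𝓝 (κs, ωs, γs), H p) :
    ∃ ε > 0, ∀ κ ∈ Ioo (κs - ε) (κs + ε), ∀ ω ∈ Ioo (ωs - ε) (ωs + ε),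
      ∀ γ ∈ Ioo (γs - ε) (γs + ε), H (κ, ω, γ) := by
  obtain ⟨ε, hε, hH⟩ := Metric.eventually_nhds_iff.mp h
  refine ⟨ε, hε, fun κ hκ ω hω γ hγ => hH ?_⟩
  rw [← Real.ball_eq_Ioo] at hκ hω hγ
  rw [Prod.dist_eq, Prod.dist_eq]
  exact max_lt hκ (max_lt hω hγ)

lemma exists_rectangle {H : ℝ × ℝ → Prop} {κs γs : ℝ} (h : ∀ᶠ p in 𝓝 (κs, γs), H p) :
    ∃ ε > 0, ∀ κ ∈ Ioo (κs - ε) (κs + ε), ∀ γ ∈ Ioo (γs - ε) (γs + ε), H (κ, γ) := by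
  obtain ⟨ε, hε, hH⟩ := Metric.eventually_nhds_iff.mp h
  refine ⟨ε, hε, fun κ hκ γ hγ => hH ?_⟩
  rw [← Real.ball_eq_Ioo] at hκ hγ
  rw [Prod.dist_eq]
  exact max_lt hκ hγ

lemma eventually_dOmega_pos {f : ℝ × ℝ × ℝ → ℝ} {q : ℝ × ℝ × ℝ} (hf : ContDiffAt ℝ ⊤ f q)
    (h : 0 < dOmega f q) : ∀ᶠ p in 𝓝 q, DifferentiableAt ℝ f p ∧ 0 < dOmega f p := by
  have hd : ∀ᶠ p in 𝓝 q, DifferentiableAt ℝ f p :=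
    (hf.eventually (by simp)).mono fun p hp => hp.differentiableAt (by simp)
  have hc : ContinuousAt (fun p => fderiv ℝ f p (0, 1, 0)) q :=
    (hf.fderiv_right (m := 0) (by simp)).continuousAt.clm_apply continuousAt_const
  rw [dOmega_eq_fderiv hd.self_of_nhds] at h
  filter_upwards [hd, hc.eventually_const_lt h] with p hp hp'
  exact ⟨hp, by rwa [dOmega_eq_fderiv hp]⟩

lemma strictMonoOn_of_dOmega_pos {f : ℝ × ℝ × ℝ → ℝ} {κ γ v₁ v₂ : ℝ}
    (h : ∀ ω ∈ Ioo v₁ v₂, DifferentiableAt ℝ f (κ, ω, γ) ∧ 0 < dOmega f (κ, ω, γ)) :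
    StrictMonoOn (fun ω => f (κ, ω, γ)) (Ioo v₁ v₂) := by
  refine strictMonoOn_of_deriv_pos (convex_Ioo _ _) ?_ ?_
  · intro ω hω
    exact (hasDerivAt_dOmega (h ω hω).1).continuousAt.continuousWithinAt
  · intro ω hω
    rw [interior_Ioo] at hω
    exact (h ω hω).2

/-- If `D ≤ 0` wherever `Q = 0`, the sign of `∂D/∂ω` decides the order of the roots in `ω` of `Q`
and of `D`. -/
lemma eventually_roots_ordered {Q D : ℝ × ℝ × ℝ → ℝ} {q : ℝ × ℝ × ℝ} (hD : ContDiffAt ℝ ⊤ D q)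
    (hDω : dOmega D q ≠ 0) (hsign : ∀ᶠ p in 𝓝 q, Q p = 0 → D p ≤ 0) :
    ∃ ε > 0, (∀ κ ∈ Ioo (q.1 - ε) (q.1 + ε), ∀ γ ∈ Ioo (q.2.2 - ε) (q.2.2 + ε),
      ∀ ω₁ ∈ Ioo (q.2.1 - ε) (q.2.1 + ε), ∀ ω₂ ∈ Ioo (q.2.1 - ε) (q.2.1 + ε),
      Q (κ, ω₁, γ) = 0 → D (κ, ω₂, γ) = 0 → ω₁ ≤ ω₂) ∨
      (∀ κ ∈ Ioo (q.1 - ε) (q.1 + ε), ∀ γ ∈ Ioo (q.2.2 - ε) (q.2.2 + ε),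
      ∀ ω₁ ∈ Ioo (q.2.1 - ε) (q.2.1 + ε), ∀ ω₂ ∈ Ioo (q.2.1 - ε) (q.2.1 + ε),
      Q (κ, ω₁, γ) = 0 → D (κ, ω₂, γ) = 0 → ω₂ ≤ ω₁) := by
  rcases hDω.lt_or_gt with hneg | hpos
  · have hn : dOmega (fun p => -D p) q = -dOmega D q := deriv.fun_neg
    obtain ⟨ε, hε, H⟩ := exists_box ((eventually_dOmega_pos hD.neg
      (show 0 < dOmega (fun p => -D p) q by rw [hn]; linarith)).and hsign)
    refine ⟨ε, hε, Or.inr fun κ hκ γ hγ ω₁ h₁ ω₂ h₂ hQ h0 => ?_⟩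
    by_contra hlt
    have h3 := strictMonoOn_of_dOmega_pos (fun ω hω => (H κ hκ ω hω γ hγ).1) h₁ h₂ (not_le.mp hlt)
    have h4 := (H κ hκ ω₁ h₁ γ hγ).2 hQ
    simp only [h0] at h3
    linarith
  · obtain ⟨ε, hε, H⟩ := exists_box ((eventually_dOmega_pos hD hpos).and hsign)
    refine ⟨ε, hε, Or.inl fun κ hκ γ hγ ω₁ h₁ ω₂ h₂ hQ h0 => ?_⟩
    by_contra hlt
    have h3 := strictMonoOn_of_dOmega_pos (fun ω hω => (H κ hκ ω hω γ hγ).1) h₂ h₁ (not_le.mp hlt)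
    have h4 := (H κ hκ ω₁ h₁ γ hγ).2 hQ
    simp only [h0] at h3
    linarith

/-! ### The bifurcation of abstract zero sets -/

/-- The geometric core of the bifurcation, free of the lattice: `E₀ = E₁ = 0` is the condition for
a guided mode, `Q = 0` and `D = 0` are the conditions for vanishing reflection and vanishing
transmission. -/
lemma exists_bifurcation {E₀ E₁ Q D : ℝ × ℝ × ℝ → ℝ} {ωs γs : ℝ} {ev a b : ℝ × ℝ × ℝ → ℂ}
    (hE₀ : ContDiffAt ℝ ⊤ E₀ (0, ωs, γs)) (hE₁ : ContDiffAt ℝ ⊤ E₁ (0, ωs, γs))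
    (hQ : ContDiffAt ℝ ⊤ Q (0, ωs, γs)) (hD : ContDiffAt ℝ ⊤ D (0, ωs, γs))
    (hE₀s : E₀ (0, ωs, γs) = 0) (hE₁s : E₁ (0, ωs, γs) = 0)
    (hj : jacobian E₀ E₁ (0, ωs, γs) ≠ 0)
    (hQω : dOmega Q (0, ωs, γs) ≠ 0) (hDω : dOmega D (0, ωs, γs) ≠ 0)
    (heven₀ : ∀ κ ω γ, E₀ (-κ, ω, γ) = E₀ (κ, ω, γ))
    (heven₁ : ∀ κ ω γ, E₁ (-κ, ω, γ) = E₁ (κ, ω, γ))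
    (hEQ : ∀ᶠ p in 𝓝 (0, ωs, γs), (E₀ p = 0 ∧ E₁ p = 0) ↔ (Q p = 0 ∧ D p = 0))
    (hsign : ∀ᶠ p in 𝓝 (0, ωs, γs), Q p = 0 → D p ≤ 0)
    (hev : ∀ᶠ p in 𝓝 (0, ωs, γs), ev p = 0 ↔ (E₀ p = 0 ∧ E₁ p = 0))
    (ha : ∀ᶠ p in 𝓝 (0, ωs, γs), Q p = 0 → a p = 0)
    (hb : ∀ᶠ p in 𝓝 (0, ωs, γs), D p = 0 → b p = 0) :
    ∃ (δ j₁ j₂ v₁ v₂ : ℝ) (I J V : Set ℝ) (ωa ωb : ℝ → ℝ → ℝ) (g W : ℝ → ℝ),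
      0 < δ ∧ I = Ioo (-δ) δ ∧ J = Ioo j₁ j₂ ∧ γs ∈ J ∧ V = Ioo v₁ v₂ ∧ ωs ∈ V ∧
      ContDiffOn ℝ ((⊤ : ℕ∞) : WithTop ℕ∞) (fun x : ℝ × ℝ => ωa x.1 x.2) (I ×ˢ J) ∧
      ContDiffOn ℝ ((⊤ : ℕ∞) : WithTop ℕ∞) (fun x : ℝ × ℝ => ωb x.1 x.2) (I ×ˢ J) ∧
      ContDiffOn ℝ ((⊤ : ℕ∞) : WithTop ℕ∞) g I ∧ ContDiffOn ℝ ((⊤ : ℕ∞) : WithTop ℕ∞) W I ∧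
      (∀ κ ∈ I, ∀ γ₀ ∈ J, ωa κ γ₀ ∈ V ∧ ωb κ γ₀ ∈ V ∧
        a (κ, ωa κ γ₀, γ₀) = 0 ∧ b (κ, ωb κ γ₀, γ₀) = 0) ∧
      (∀ κ₀ ∈ I, g κ₀ ∈ J ∧ W κ₀ ∈ V ∧ ev (κ₀, W κ₀, g κ₀) = 0) ∧
      (∀ κ ∈ I, ∀ ω ∈ V, ∀ γ₀ ∈ J, ev (κ, ω, γ₀) = 0 ↔ ω = W κ ∧ γ₀ = g κ) ∧
      g 0 = γs ∧ W 0 = ωs ∧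
      (deriv (deriv g) 0 < 0 → (∃ κ ∈ I, ωa κ γs < ωb κ γs) →
        Bifurcates I J ωs γs ωa ωb g W (· < ·) (· < ·)) ∧
      (deriv (deriv g) 0 < 0 → (∃ κ ∈ I, ωa κ γs > ωb κ γs) →
        Bifurcates I J ωs γs ωa ωb g W (· > ·) (· < ·)) ∧
      (deriv (deriv g) 0 > 0 → (∃ κ ∈ I, ωa κ γs < ωb κ γs) →
        Bifurcates I J ωs γs ωa ωb g W (· < ·) (· > ·)) ∧
      (deriv (deriv g) 0 > 0 → (∃ κ ∈ I, ωa κ γs > ωb κ γs) →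
        Bifurcates I J ωs γs ωa ωb g W (· > ·) (· > ·)) := by
  obtain ⟨hQs, hDs⟩ := hEQ.self_of_nhds.mp ⟨hE₀s, hE₁s⟩
  obtain ⟨ψa, hψa0, hψa1, hψa2⟩ := exists_implicit_frequency hQ hQs hQω
  obtain ⟨ψb, hψb0, hψb1, hψb2⟩ := exists_implicit_frequency hD hDs hDω
  obtain ⟨ψ, hψ0, hψ1, hψ2⟩ := exists_implicit_pair hE₀ hE₁ hE₀s hE₁s hj
  dsimp only at hψa0 hψa1 hψb0 hψb1 hψ0 hψ1
  obtain ⟨ε₁, hε₁, hord⟩ := eventually_roots_ordered hD hDω hsign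
  obtain ⟨ε₂, hε₂, hbox⟩ :=
    exists_box (hψa2.and (hψb2.and (hψ2.and (hEQ.and (hev.and (ha.and hb))))))
  -- The frequency interval `V` has half-width `ε`; it is fixed before the other two intervals.
  obtain ⟨ε, hε, hεlt⟩ := exists_between (lt_min hε₁ hε₂)
  have hε1 : ε < ε₁ := hεlt.trans_le (min_le_left _ _)
  have hε2 : ε < ε₂ := hεlt.trans_le (min_le_right _ _)
  have hV : ∀ᶠ x in 𝓝 (0, γs), ψa x ∈ Ioo (ωs - ε) (ωs + ε) ∧ ψb x ∈ Ioo (ωs - ε) (ωs + ε) := by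
    have hmem : Ioo (ωs - ε) (ωs + ε) ∈ 𝓝 ωs := Ioo_mem_nhds (by linarith) (by linarith)
    refine (hψa1.self_of_nhds.continuousAt.eventually_mem ?_).and
      (hψb1.self_of_nhds.continuousAt.eventually_mem ?_)
    · rwa [hψa0]
    · rwa [hψb0]
  obtain ⟨η₁, hη₁, hrect⟩ := exists_rectangle (hψa1.and (hψb1.and hV))
  obtain ⟨η, hη, hηlt⟩ := exists_between (lt_min hη₁ hε)
  have hη1 : η < η₁ := hηlt.trans_le (min_le_left _ _)
  have hηε : η < ε := hηlt.trans_le (min_le_right _ _)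
  have hψV : ∀ᶠ κ in 𝓝 (0 : ℝ), (ψ κ).1 ∈ Ioo (ωs - ε) (ωs + ε) ∧
      (ψ κ).2 ∈ Ioo (γs - η) (γs + η) := by
    have hc := hψ1.self_of_nhds.continuousAt
    refine (hc.fst.eventually_mem ?_).and (hc.snd.eventually_mem ?_)
    · rw [hψ0]
      exact Ioo_mem_nhds (by linarith) (by linarith)
    · rw [hψ0]
      exact Ioo_mem_nhds (by linarith) (by linarith)
  obtain ⟨δ₁, hδ₁, hline⟩ := Metric.eventually_nhds_iff.mp (hψ1.and hψV)
  obtain ⟨δ₀, hδ₀, hδ₀lt⟩ := exists_between (lt_min hδ₁ hη)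
  have hδ1 : δ₀ < δ₁ := hδ₀lt.trans_le (min_le_left _ _)
  have hδη : δ₀ < η := hδ₀lt.trans_le (min_le_right _ _)
  have hline' : ∀ κ ∈ Ioo (-δ₀) δ₀, ContDiffAt ℝ ⊤ ψ κ ∧ (ψ κ).1 ∈ Ioo (ωs - ε) (ωs + ε) ∧
      (ψ κ).2 ∈ Ioo (γs - η) (γs + η) := by
    intro κ hκ
    refine hline ?_
    rw [Real.dist_eq, sub_zero]
    exact (abs_lt.mpr hκ).trans hδ1
  have hbox' : ∀ κ ∈ Ioo (-δ₀) δ₀, ∀ ω ∈ Ioo (ωs - ε) (ωs + ε), ∀ γ ∈ Ioo (γs - η) (γs + η), _ :=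
    fun κ hκ ω hω γ hγ => hbox κ ⟨by linarith [hκ.1], by linarith [hκ.2]⟩
      ω ⟨by linarith [hω.1], by linarith [hω.2]⟩ γ ⟨by linarith [hγ.1], by linarith [hγ.2]⟩
  have hrect' : ∀ κ ∈ Ioo (-δ₀) δ₀, ∀ γ ∈ Ioo (γs - η) (γs + η), _ :=
    fun κ hκ γ hγ => hrect κ ⟨by linarith [hκ.1], by linarith [hκ.2]⟩
      γ ⟨by linarith [hγ.1], by linarith [hγ.2]⟩
  set g : ℝ → ℝ := fun κ => (ψ κ).2 with hg
  set W : ℝ → ℝ := fun κ => (ψ κ).1 with hW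
  have hg0 : g 0 = γs := by simp [hg, hψ0]
  have hW0 : W 0 = ωs := by simp [hW, hψ0]
  have hzero : ∀ κ ∈ Ioo (-δ₀) δ₀, E₀ (κ, W κ, g κ) = 0 ∧ E₁ (κ, W κ, g κ) = 0 := fun κ hκ =>
    (hbox' κ hκ _ (hline' κ hκ).2.1 _ (hline' κ hκ).2.2).2.2.1.mpr rfl
  have heven : ∀ κ ∈ Ioo (-δ₀) δ₀, g (-κ) = g κ := by
    intro κ hκ
    have hκ' : -κ ∈ Ioo (-δ₀) δ₀ := ⟨by linarith [hκ.2], by linarith [hκ.1]⟩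
    have h := (hbox' (-κ) hκ' _ (hline' κ hκ).2.1 _ (hline' κ hκ).2.2).2.2.1.mp
      (by rw [heven₀, heven₁]; exact hzero κ hκ)
    simp only [hg, h]
  obtain ⟨δ, j₁, j₂, hδ, hδle, hγJ, hJ, hgJ, hbneg, hbpos⟩ :=
    exists_bifurcation_intervals (g := g) (η := η) hδ₀
      (fun x hx => (hline' x hx).1.snd) heven
      (fun x hx => by rw [hg0]; exact (hline' x hx).2.2)
  rw [hg0] at hγJ hJ hbneg hbpos
  have hI : Ioo (-δ) δ ⊆ Ioo (-δ₀) δ₀ := Ioo_subset_Ioo (by linarith) hδle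
  have hmeet : ∀ κ ∈ Ioo (-δ) δ, ∀ γ ∈ Ioo j₁ j₂, γ = g κ →
      ψa (κ, γ) = W κ ∧ ψb (κ, γ) = W κ := by
    rintro κ hκ γ hγ rfl
    have hb := hbox' κ (hI hκ) _ (hline' κ (hI hκ)).2.1 _ (hline' κ (hI hκ)).2.2
    obtain ⟨hq, hd⟩ := hb.2.2.2.1.mp (hzero κ (hI hκ))
    exact ⟨hb.1.mp hq, hb.2.1.mp hd⟩
  have hroots : ∀ κ ∈ Ioo (-δ) δ, ∀ γ ∈ Ioo j₁ j₂,
      Q (κ, ψa (κ, γ), γ) = 0 ∧ D (κ, ψb (κ, γ), γ) = 0 := by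
    intro κ hκ γ hγ
    have hr := hrect' κ (hI hκ) γ (hJ hγ)
    exact ⟨(hbox' κ (hI hκ) _ hr.2.2.1 γ (hJ hγ)).1.mpr rfl,
      (hbox' κ (hI hκ) _ hr.2.2.2 γ (hJ hγ)).2.1.mpr rfl⟩
  have hapart : ∀ κ ∈ Ioo (-δ) δ, ∀ γ ∈ Ioo j₁ j₂, γ ≠ g κ → ψa (κ, γ) ≠ ψb (κ, γ) := by
    intro κ hκ γ hγ hne heq
    have hr := hrect' κ (hI hκ) γ (hJ hγ)
    have hab := hroots κ hκ γ hγ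
    rw [← heq] at hab
    have hb := hbox' κ (hI hκ) _ hr.2.2.1 γ (hJ hγ)
    have := hb.2.2.1.mp (hb.2.2.2.1.mpr hab)
    exact hne (by simp [hg, this])
  -- The sign of `∂D/∂ω` decides the order once and for all on `I × J`.
  have hcases : (∀ κ ∈ Ioo (-δ) δ, ∀ γ ∈ Ioo j₁ j₂, ψa (κ, γ) ≤ ψb (κ, γ)) ∨
      (∀ κ ∈ Ioo (-δ) δ, ∀ γ ∈ Ioo j₁ j₂, ψb (κ, γ) ≤ ψa (κ, γ)) := by
    have hin : ∀ κ ∈ Ioo (-δ) δ, ∀ γ ∈ Ioo j₁ j₂, κ ∈ Ioo (0 - ε₁) (0 + ε₁) ∧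
        γ ∈ Ioo (γs - ε₁) (γs + ε₁) ∧ ψa (κ, γ) ∈ Ioo (ωs - ε₁) (ωs + ε₁) ∧
        ψb (κ, γ) ∈ Ioo (ωs - ε₁) (ωs + ε₁) := by
      intro κ hκ γ hγ
      have h1 := hI hκ
      have h2 := hJ hγ
      obtain ⟨-, -, h3, h4⟩ := hrect' κ h1 γ h2
      exact ⟨⟨by linarith [h1.1], by linarith [h1.2]⟩, ⟨by linarith [h2.1], by linarith [h2.2]⟩,
        ⟨by linarith [h3.1], by linarith [h3.2]⟩, ⟨by linarith [h4.1], by linarith [h4.2]⟩⟩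
    rcases hord with h | h
    · left
      intro κ hκ γ hγ
      obtain ⟨h1, h2, h3, h4⟩ := hin κ hκ γ hγ
      exact h κ h1 γ h2 _ h3 _ h4 (hroots κ hκ γ hγ).1 (hroots κ hκ γ hγ).2
    · right
      intro κ hκ γ hγ
      obtain ⟨h1, h2, h3, h4⟩ := hin κ hκ γ hγ
      exact h κ h1 γ h2 _ h3 _ h4 (hroots κ hκ γ hγ).1 (hroots κ hκ γ hγ).2
  have horder_lt : (∃ κ ∈ Ioo (-δ) δ, ψa (κ, γs) < ψb (κ, γs)) →
      ∀ κ ∈ Ioo (-δ) δ, ∀ γ ∈ Ioo j₁ j₂, γ ≠ g κ → ψa (κ, γ) < ψb (κ, γ) := by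
    rintro ⟨κ', hκ', hlt⟩ κ hκ γ hγ hne
    rcases hcases with h | h
    · exact lt_of_le_of_ne (h κ hκ γ hγ) (hapart κ hκ γ hγ hne)
    · exact absurd (h κ' hκ' γs hγJ) (not_le.mpr hlt)
  have horder_gt : (∃ κ ∈ Ioo (-δ) δ, ψa (κ, γs) > ψb (κ, γs)) →
      ∀ κ ∈ Ioo (-δ) δ, ∀ γ ∈ Ioo j₁ j₂, γ ≠ g κ → ψa (κ, γ) > ψb (κ, γ) := by
    rintro ⟨κ', hκ', hlt⟩ κ hκ γ hγ hne
    rcases hcases with h | h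
    · exact absurd (h κ' hκ' γs hγJ) (not_le.mpr hlt)
    · exact lt_of_le_of_ne (h κ hκ γ hγ) (hapart κ hκ γ hγ hne).symm
  have hasymm_lt : ∀ x y : ℝ, x < y → ¬ y < x := fun x y h => not_lt.mpr h.le
  have hasymm_gt : ∀ x y : ℝ, x > y → ¬ y > x := fun x y h => not_lt.mpr (le_of_lt h)
  have hevenI : ∀ κ ∈ Ioo (-δ) δ, g (-κ) = g κ := fun κ hκ => heven κ (hI hκ)
  refine ⟨δ, j₁, j₂, ωs - ε, ωs + ε, Ioo (-δ) δ, Ioo j₁ j₂, Ioo (ωs - ε) (ωs + ε),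
    fun κ γ => ψa (κ, γ), fun κ γ => ψb (κ, γ), g, W, hδ, rfl, rfl, hγJ, rfl,
    ⟨by linarith, by linarith⟩, ?_, ?_, ?_, ?_, ?_, ?_, ?_, hg0, hW0, ?_, ?_, ?_, ?_⟩
  · exact fun x hx => ((hrect' x.1 (hI hx.1) x.2 (hJ hx.2)).1.of_le le_top).contDiffWithinAt
  · exact fun x hx => ((hrect' x.1 (hI hx.1) x.2 (hJ hx.2)).2.1.of_le le_top).contDiffWithinAt
  · exact fun x hx => ((hline' x (hI hx)).1.snd.of_le le_top).contDiffWithinAt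
  · exact fun x hx => ((hline' x (hI hx)).1.fst.of_le le_top).contDiffWithinAt
  · intro κ hκ γ hγ
    have hr := hrect' κ (hI hκ) γ (hJ hγ)
    exact ⟨hr.2.2.1, hr.2.2.2,
      (hbox' κ (hI hκ) _ hr.2.2.1 γ (hJ hγ)).2.2.2.2.2.1 (hroots κ hκ γ hγ).1,
      (hbox' κ (hI hκ) _ hr.2.2.2 γ (hJ hγ)).2.2.2.2.2.2 (hroots κ hκ γ hγ).2⟩
  · intro κ hκ
    have hl := hline' κ (hI hκ)
    exact ⟨hgJ κ hκ, hl.2.1,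
      (hbox' κ (hI hκ) _ hl.2.1 _ hl.2.2).2.2.2.2.1.mpr (hzero κ (hI hκ))⟩
  · intro κ hκ ω hω γ hγ
    have hb := hbox' κ (hI hκ) ω hω γ (hJ hγ)
    rw [hb.2.2.2.2.1, hb.2.2.1, Prod.ext_iff, eq_comm, @eq_comm _ (ψ (κ, ω, γ).1).2]
  · exact fun h2 hex => Bifurcates.of_graph hδ hasymm_lt hγJ hg0 hW0 hevenI (hbneg h2).1
      (hbneg h2).2 hmeet (horder_lt hex)
  · exact fun h2 hex => Bifurcates.of_graph hδ hasymm_lt hγJ hg0 hW0 hevenI (hbneg h2).1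
      (hbneg h2).2 hmeet (horder_gt hex)
  · exact fun h2 hex => Bifurcates.of_graph hδ hasymm_gt hγJ hg0 hW0 hevenI (hbpos h2).1
      (hbpos h2).2 hmeet (horder_lt hex)
  · exact fun h2 hex => Bifurcates.of_graph hδ hasymm_gt hγJ hg0 hW0 hevenI (hbpos h2).1
      (hbpos h2).2 hmeet (horder_gt hex)

/-! ### Harmonics -/

lemma fourier_zero_left (n : Fin 2) : fourier 0 n = 1 := by simp [fourier]

lemma fourier_one_zero : fourier 1 0 = 1 := by simp [fourier]

lemma fourier_one_one : fourier 1 1 = -1 := by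
  simp [fourier]
  rw [show 2 * (Real.pi : ℂ) * Complex.I / 2 = Real.pi * Complex.I by ring, Complex.exp_pi_mul_I]

lemma cos_two_pi_phi_zero (κ : ℝ) : Real.cos (2 * Real.pi * phi κ 0) = Real.cos (Real.pi * κ) := by
  congr 1
  simp [phi]
  ring

lemma cos_two_pi_phi_one (κ : ℝ) :
    Real.cos (2 * Real.pi * phi κ 1) = -Real.cos (Real.pi * κ) := by
  rw [← Real.cos_add_pi]
  congr 1
  simp [phi]
  ring

lemma step_ne_zero (κ ω : ℝ) (l : Fin 2) : step κ ω l ≠ 0 := Complex.exp_ne_zero _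

lemma step_zero_of_propagating {κ ω : ℝ} (h : |cosTheta κ ω 0| < 1) :
    step κ ω 0 = Complex.exp ((Real.arccos (cosTheta κ ω 0) : ℝ) * Complex.I) := by
  have hpi : (Real.pi : ℂ) ≠ 0 := by exact_mod_cast Real.pi_ne_zero
  rw [step, theta, if_pos h.le]
  congr 1
  push_cast
  field_simp

lemma step_one_of_evanescent {κ ω : ℝ} (h : 1 < cosTheta κ ω 1) :
    step κ ω 1 = Complex.exp ((-Real.arcosh (cosTheta κ ω 1) : ℝ)) := by
  have hpi : (Real.pi : ℂ) ≠ 0 := by exact_mod_cast Real.pi_ne_zero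
  rw [step, theta, if_neg (not_le.mpr (h.trans_le (le_abs_self _))), if_pos h]
  congr 1
  push_cast
  field_simp
  rw [Complex.I_sq]
  ring

lemma step_sub_inv_of_propagating {κ ω : ℝ} (h : |cosTheta κ ω 0| < 1) :
    step κ ω 0 - (step κ ω 0)⁻¹
      = 2 * Complex.I * (Real.sqrt (1 - cosTheta κ ω 0 ^ 2) : ℝ) := by
  rw [step_zero_of_propagating h, ← Complex.exp_neg, ← neg_mul, Complex.exp_mul_I,
    Complex.exp_mul_I, Complex.cos_neg, Complex.sin_neg, ← Real.sin_arccos, Complex.ofReal_sin]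
  ring

lemma step_sub_inv_of_evanescent {κ ω : ℝ} (h : 1 < cosTheta κ ω 1) :
    step κ ω 1 - (step κ ω 1)⁻¹ = (evanescentFactor κ ω : ℝ) := by
  have hs := Real.sinh_arcosh h.le
  rw [step_one_of_evanescent h, ← Complex.exp_neg, evanescentFactor]
  have hx : 2 - ω / 2 + Real.cos (Real.pi * κ) = cosTheta κ ω 1 := by
    rw [cosTheta, cos_two_pi_phi_one]
    ring
  rw [hx, ← hs, Real.sinh_eq]
  push_cast
  rw [neg_neg]
  ring

lemma evanescentFactor_ne_zero {κ ω : ℝ} (h : 1 < cosTheta κ ω 1) : evanescentFactor κ ω ≠ 0 := by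
  have hx : 2 - ω / 2 + Real.cos (Real.pi * κ) = cosTheta κ ω 1 := by
    rw [cosTheta, cos_two_pi_phi_one]
    ring
  rw [evanescentFactor, hx]
  have : 0 < Real.sqrt (cosTheta κ ω 1 ^ 2 - 1) := Real.sqrt_pos.mpr (by nlinarith)
  linarith

lemma continuous_cosTheta (l : Fin 2) :
    Continuous fun p : ℝ × ℝ × ℝ => cosTheta p.1 p.2.1 l := by
  unfold cosTheta phi
  fun_prop

/-- Near a point with one propagating harmonic, the harmonic `1` decays without oscillating. -/
lemma eventually_regime {ωs γs : ℝ} (h : OnePropagating 0 ωs) :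
    ∀ᶠ p in 𝓝 ((0, ωs, γs) : ℝ × ℝ × ℝ),
      |cosTheta p.1 p.2.1 0| < 1 ∧ 1 < cosTheta p.1 p.2.1 1 := by
  have h1 : 1 < cosTheta 0 ωs 1 := by
    have h0 := abs_lt.mp h.1
    simp only [cosTheta, cos_two_pi_phi_zero, cos_two_pi_phi_one, mul_zero, Real.cos_zero] at h0 ⊢
    linarith [h0.1]
  have hc0 : ContinuousAt (fun p : ℝ × ℝ × ℝ => |cosTheta p.1 p.2.1 0|) (0, ωs, γs) :=
    (continuous_cosTheta 0).abs.continuousAt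
  have hc1 : ContinuousAt (fun p : ℝ × ℝ × ℝ => cosTheta p.1 p.2.1 1) (0, ωs, γs) :=
    (continuous_cosTheta 1).continuousAt
  exact (hc0.eventually_lt_const h.1).and (hc1.eventually_const_lt h1)

/-! ### Reduction to the waveguide sites -/

/-- The strength of the coupling of neighbouring waveguide sites on a Bloch field. -/
noncomputable def hopping (M : Fin 2 → ℝ) (k κ : ℝ) : ℝ :=
  2 * k * Real.cos (Real.pi * κ) / Real.sqrt (M 0 * M 1)

lemma waveguideSymbol_equal_springs (M : Fin 2 → ℝ) (k κ ω : ℝ) (n l : Fin 2) :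
    waveguideSymbol M (fun _ => k) κ ω n l = (ω - 2 * k / M n : ℝ)
      + (2 * k * Real.cos (2 * Real.pi * phi κ l) / Real.sqrt (M 0 * M 1) : ℝ) := by
  have hsq : Real.sqrt (M n * M (n + 1)) = Real.sqrt (M 0 * M 1) ∧
      Real.sqrt (M n * M (n - 1)) = Real.sqrt (M 0 * M 1) := by
    have h1 : (-1 : Fin 2) = 1 := rfl
    fin_cases n <;> simp [mul_comm, h1]
  rw [waveguideSymbol, hsq.1, hsq.2]
  push_cast
  rw [Complex.cos]
  rw [show (2 * Real.pi * phi κ l : ℂ) * Complex.I = 2 * Real.pi * Complex.I * phi κ l by ring,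
    show -(2 * Real.pi * phi κ l : ℂ) * Complex.I = -(2 * Real.pi * Complex.I * phi κ l) by ring]
  ring

lemma waveguideSymbol_zero (M : Fin 2 → ℝ) (k κ ω : ℝ) (n : Fin 2) :
    waveguideSymbol M (fun _ => k) κ ω n 0 = (ω - 2 * k / M n : ℝ) + (hopping M k κ : ℝ) := by
  rw [waveguideSymbol_equal_springs, cos_two_pi_phi_zero, hopping]

lemma waveguideSymbol_one (M : Fin 2 → ℝ) (k κ ω : ℝ) (n : Fin 2) :
    waveguideSymbol M (fun _ => k) κ ω n 1 = (ω - 2 * k / M n : ℝ) - (hopping M k κ : ℝ) := by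
  rw [waveguideSymbol_equal_springs, cos_two_pi_phi_one, hopping]
  push_cast
  ring

/-- The entry `(0, 0)` of the real symmetric operator that acts on the values of the field at the
two waveguide sites, the evanescent harmonic having been eliminated. -/
noncomputable def site₀₀ (M : Fin 2 → ℝ) (k : ℝ) (p : ℝ × ℝ × ℝ) : ℝ :=
  p.2.1 - 2 * k / M 0 - p.2.2 ^ 2 / (2 * evanescentFactor p.1 p.2.1)

/-- The entry `(0, 1)` of the operator described at `site₀₀`. -/
noncomputable def site₀₁ (M : Fin 2 → ℝ) (k γ₁ : ℝ) (p : ℝ × ℝ × ℝ) : ℝ :=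
  hopping M k p.1 + p.2.2 * γ₁ / (2 * evanescentFactor p.1 p.2.1)

/-- The entry `(1, 1)` of the operator described at `site₀₀`. -/
noncomputable def site₁₁ (M : Fin 2 → ℝ) (k γ₁ : ℝ) (p : ℝ × ℝ × ℝ) : ℝ :=
  p.2.1 - 2 * k / M 1 - γ₁ ^ 2 / (2 * evanescentFactor p.1 p.2.1)

/-- The determinant of the site operator `S`. Its zeros are those of the transmitted amplitude. -/
noncomputable def siteDet (M : Fin 2 → ℝ) (k γ₁ : ℝ) (p : ℝ × ℝ × ℝ) : ℝ :=
  site₀₀ M k p * site₁₁ M k γ₁ p - site₀₁ M k γ₁ p ^ 2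

/-- The quadratic form of the adjugate of the site operator `S` at the coupling vector
`(γ₀, γ₁)`, or of `S` at the vector `(γ₁, -γ₀)` of a guided mode. Its zeros are those of the
reflected amplitude. -/
noncomputable def siteForm (M : Fin 2 → ℝ) (k γ₁ : ℝ) (p : ℝ × ℝ × ℝ) : ℝ :=
  γ₁ ^ 2 * site₀₀ M k p - 2 * (p.2.2 * γ₁) * site₀₁ M k γ₁ p + p.2.2 ^ 2 * site₁₁ M k γ₁ p

/-- The positive number `sin (2πθ_0)` for the propagating harmonic. -/
noncomputable def propagatingFactor (κ ω : ℝ) : ℝ := Real.sqrt (1 - cosTheta κ ω 0 ^ 2)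

/-- The characteristic function of the scattering problem, a multiple of the determinant of the
scattering matrix. -/
noncomputable def characteristic (M : Fin 2 → ℝ) (k γ₁ : ℝ) (p : ℝ × ℝ × ℝ) : ℂ :=
  4 * Complex.I * (propagatingFactor p.1 p.2.1 : ℝ) * (siteDet M k γ₁ p : ℝ)
    - (siteForm M k γ₁ p : ℝ)

set_option maxRecDepth 4000 in
set_option maxHeartbeats 1000000 in
/-- The determinant of the scattering matrix with its entries replaced by free symbols. -/
lemma det_six (s₀ s₁ t₀ t₁ g₀ g₁ A₀ A₁ τ : ℂ) :
    Matrix.det (!![1, 1, -1, -1, 0, 0;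
      1, -1, -1, 1, 0, 0;
      s₀, s₁, -t₀, -t₁, -g₀, -g₀;
      s₀, -s₁, -t₀, t₁, -g₁, g₁;
      0, 0, -g₀, -g₀, A₀ + τ, A₀ - τ;
      0, 0, -g₁, g₁, A₁ + τ, -(A₁ - τ)] : Matrix (Fin 6) (Fin 6) ℂ)
      = -4 * (2 * (s₀ - t₀) * (s₁ - t₁) * (A₀ * A₁ - τ ^ 2)
        - (s₀ - t₀) * (A₀ * g₁ ^ 2 + A₁ * g₀ ^ 2 + 2 * τ * g₀ * g₁)
        - (s₁ - t₁) * (g₁ ^ 2 * A₀ - 2 * τ * g₀ * g₁ + g₀ ^ 2 * A₁)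
        + 2 * g₀ ^ 2 * g₁ ^ 2) := by
  simp [Matrix.det_succ_row_zero, Fin.sum_univ_succ, Fin.succAbove]
  ring

lemma det_scatteringMatrix {M : Fin 2 → ℝ} {k γ₁ : ℝ} {p : ℝ × ℝ × ℝ}
    (h₀ : |cosTheta p.1 p.2.1 0| < 1) (h₁ : 1 < cosTheta p.1 p.2.1 1) :
    (scatteringMatrix M (fun _ => k) ![p.2.2, γ₁] p.1 p.2.1).det
      = -4 * (evanescentFactor p.1 p.2.1 : ℝ) * characteristic M k γ₁ p := by
  have hs₀ := step_sub_inv_of_propagating h₀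
  have hs₁ := step_sub_inv_of_evanescent h₁
  have hd : (evanescentFactor p.1 p.2.1 : ℂ) ≠ 0 := by
    exact_mod_cast evanescentFactor_ne_zero h₁
  rw [← Matrix.det_reindex_self finProdFinEquiv]
  have hm : Matrix.reindex finProdFinEquiv finProdFinEquiv
      (scatteringMatrix M (fun _ => k) ![p.2.2, γ₁] p.1 p.2.1) =
      (!![1, 1, -1, -1, 0, 0;
      1, -1, -1, 1, 0, 0;
      step p.1 p.2.1 0, step p.1 p.2.1 1, -(step p.1 p.2.1 0)⁻¹, -(step p.1 p.2.1 1)⁻¹,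
        -(p.2.2 : ℂ), -(p.2.2 : ℂ);
      step p.1 p.2.1 0, -step p.1 p.2.1 1, -(step p.1 p.2.1 0)⁻¹, (step p.1 p.2.1 1)⁻¹,
        -(γ₁ : ℂ), (γ₁ : ℂ);
      0, 0, -(p.2.2 : ℂ), -(p.2.2 : ℂ),
        (p.2.1 - 2 * k / M 0 : ℝ) + (hopping M k p.1 : ℝ),
        (p.2.1 - 2 * k / M 0 : ℝ) - (hopping M k p.1 : ℝ);
      0, 0, -(γ₁ : ℂ), (γ₁ : ℂ),
        (p.2.1 - 2 * k / M 1 : ℝ) + (hopping M k p.1 : ℝ),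
        -((p.2.1 - 2 * k / M 1 : ℝ) - (hopping M k p.1 : ℝ))] : Matrix (Fin 6) (Fin 6) ℂ) := by
    have e0 : (finProdFinEquiv (m := 3) (n := 2)).symm 0 = (0, 0) := by decide
    have e1 : (finProdFinEquiv (m := 3) (n := 2)).symm 1 = (0, 1) := by decide
    have e2 : (finProdFinEquiv (m := 3) (n := 2)).symm 2 = (1, 0) := by decide
    have e3 : (finProdFinEquiv (m := 3) (n := 2)).symm 3 = (1, 1) := by decide
    have e4 : (finProdFinEquiv (m := 3) (n := 2)).symm 4 = (2, 0) := by decide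
    have e5 : (finProdFinEquiv (m := 3) (n := 2)).symm 5 = (2, 1) := by decide
    have hall : ∀ i j : Fin 6, Matrix.reindex finProdFinEquiv finProdFinEquiv
      (scatteringMatrix M (fun _ => k) ![p.2.2, γ₁] p.1 p.2.1) i j =
      scatteringMatrix M (fun _ => k) ![p.2.2, γ₁] p.1 p.2.1
        ((finProdFinEquiv (m := 3) (n := 2)).symm i)
        ((finProdFinEquiv (m := 3) (n := 2)).symm j) := fun i j => rfl
    rw [← Matrix.ext_iff]
    simp only [hall, Fin.forall_fin_succ]
    simp [e0, e1, e2, e3, e4, e5, scatteringMatrix, fourier_zero_left, fourier_one_zero,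
      fourier_one_one, waveguideSymbol_zero, waveguideSymbol_one]
  rw [hm, det_six, hs₀, hs₁, characteristic, siteDet, siteForm, site₀₀, site₀₁, site₁₁,
    propagatingFactor]
  push_cast
  field_simp
  ring

/-- The scattering problem for a wave incident from the left with amplitude `L`, reduced to the
values `z₀`, `z₁` of the field at the two waveguide sites. -/
lemma exists_site_values {M : Fin 2 → ℝ} {k γ₁ : ℝ} {σ : Equiv.Perm (Fin 3 × Fin 2)}
    {p : ℝ × ℝ × ℝ} {L : ℂ} {Y : Fin 3 × Fin 2 → ℂ}
    (h₀ : |cosTheta p.1 p.2.1 0| < 1) (h₁ : 1 < cosTheta p.1 p.2.1 1)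
    (hY : (matB M k γ₁ σ p).mulVec Y = L • vecF γ₁ σ p) :
    ∃ z₀ z₁ : ℂ,
      site₀₀ M k p * z₀ + site₀₁ M k γ₁ p * z₁ = p.2.2 * Y (1, 0) ∧
      site₀₁ M k γ₁ p * z₀ + site₁₁ M k γ₁ p * z₁ = γ₁ * Y (1, 0) ∧
      p.2.2 * z₀ + γ₁ * z₁ = 4 * Complex.I * propagatingFactor p.1 p.2.1 * Y (0, 0) ∧
      Y (1, 0) = Y (0, 0) + L := by
  have hs₀ := step_sub_inv_of_propagating h₀
  have hs₁ := step_sub_inv_of_evanescent h₁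
  have hd : (evanescentFactor p.1 p.2.1 : ℂ) ≠ 0 := by
    exact_mod_cast evanescentFactor_ne_zero h₁
  have hrow : ∀ r, ∑ s, scatteringMatrix M (fun _ => k) ![p.2.2, γ₁] p.1 p.2.1 r s * Y s
      = L * sourceVector ![p.2.2, γ₁] p.1 p.2.1 (Pi.single 0 1) 0 r := by
    intro r
    have := congrFun hY (σ.symm r)
    simpa [Matrix.mulVec, dotProduct, matB, vecF] using this
  have e1 := hrow (0, 0)
  have e2 := hrow (0, 1)
  have e3 := hrow (1, 0)
  have e4 := hrow (1, 1)
  have e5 := hrow (2, 0)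
  have e6 := hrow (2, 1)
  simp [Fintype.sum_prod_type, Fin.sum_univ_succ, scatteringMatrix, sourceVector,
    fourier_zero_left, fourier_one_zero, fourier_one_one, waveguideSymbol_zero,
    waveguideSymbol_one] at e1 e2 e3 e4 e5 e6
  have ha : Y (0, 1) = Y (1, 1) := by linear_combination (e1 - e2) / 2
  have hab : Y (1, 0) = Y (0, 0) + L := by linear_combination -(e1 + e2) / 2
  rw [ha] at e3 e4
  rw [hab] at e3 e4 e5 e6 ⊢
  have hY1 : Y (1, 1)
      = (p.2.2 * (Y (2, 0) + Y (2, 1)) - γ₁ * (Y (2, 0) - Y (2, 1)))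
        / (2 * evanescentFactor p.1 p.2.1) := by
    rw [eq_div_iff (by simpa using hd)]
    linear_combination e3 - e4 - 2 * Y (1, 1) * hs₁
  refine ⟨Y (2, 0) + Y (2, 1), Y (2, 0) - Y (2, 1), ?_, ?_, ?_, rfl⟩
  · rw [site₀₀, site₀₁]
    have : (p.2.1 - 2 * k / M 0 : ℂ) * (Y (2, 0) + Y (2, 1))
        + hopping M k p.1 * (Y (2, 0) - Y (2, 1)) - p.2.2 * Y (1, 1)
        = p.2.2 * (Y (0, 0) + L) := by
      linear_combination e5
    rw [hY1] at this
    rw [← this]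
    push_cast
    field_simp
    ring
  · rw [site₁₁, site₀₁]
    have : (p.2.1 - 2 * k / M 1 : ℂ) * (Y (2, 0) - Y (2, 1))
        + hopping M k p.1 * (Y (2, 0) + Y (2, 1)) + γ₁ * Y (1, 1)
        = γ₁ * (Y (0, 0) + L) := by
      linear_combination e6
    rw [hY1] at this
    rw [← this]
    push_cast
    field_simp
    ring
  · have hs₀' : step p.1 p.2.1 0 - (step p.1 p.2.1 0)⁻¹
        = 2 * Complex.I * propagatingFactor p.1 p.2.1 := hs₀
    linear_combination 2 * Y (0, 0) * hs₀' - e3 - e4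

lemma propagatingFactor_pos {κ ω : ℝ} (h : |cosTheta κ ω 0| < 1) : 0 < propagatingFactor κ ω := by
  refine Real.sqrt_pos.mpr ?_
  have := abs_lt.mp h
  nlinarith

/-- The reflected and transmitted amplitudes, up to the characteristic function, and conservation
of energy in the only form needed: without incident wave nothing is scattered. -/
lemma amplitudes_of_solves {M : Fin 2 → ℝ} {k γ₁ : ℝ} {σ : Equiv.Perm (Fin 3 × Fin 2)}
    {p : ℝ × ℝ × ℝ} {L : ℂ} {Y : Fin 3 × Fin 2 → ℂ}
    (h₀ : |cosTheta p.1 p.2.1 0| < 1) (h₁ : 1 < cosTheta p.1 p.2.1 1)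
    (hY : (matB M k γ₁ σ p).mulVec Y = L • vecF γ₁ σ p) :
    characteristic M k γ₁ p * Y (0, 0) = siteForm M k γ₁ p * L ∧
    characteristic M k γ₁ p * Y (1, 0)
      = 4 * Complex.I * propagatingFactor p.1 p.2.1 * siteDet M k γ₁ p * L ∧
    (L = 0 → Y (0, 0) = 0 ∧ Y (1, 0) = 0) := by
  obtain ⟨z₀, z₁, e1, e2, e3, e4⟩ := exists_site_values h₀ h₁ hY
  have key : 4 * Complex.I * propagatingFactor p.1 p.2.1 * siteDet M k γ₁ p * Y (0, 0)
      = siteForm M k γ₁ p * Y (1, 0) := by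
    rw [siteDet, siteForm]
    push_cast
    linear_combination
      -((site₀₀ M k p : ℂ) * site₁₁ M k γ₁ p - (site₀₁ M k γ₁ p : ℂ) ^ 2) * e3
      + (p.2.2 * site₁₁ M k γ₁ p - γ₁ * site₀₁ M k γ₁ p) * e1
      + (γ₁ * site₀₀ M k p - p.2.2 * site₀₁ M k γ₁ p) * e2
  refine ⟨?_, ?_, ?_⟩
  · rw [characteristic]
    linear_combination key + siteForm M k γ₁ p * e4
  · rw [characteristic]
    linear_combination key
      + 4 * Complex.I * propagatingFactor p.1 p.2.1 * siteDet M k γ₁ p * e4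
  · intro hL
    rw [hL, add_zero] at e4
    rw [e4] at e1 e2
    have hs := propagatingFactor_pos h₀
    -- The quadratic form of the real symmetric site operator at `(z₀, z₁)` is real, whereas
    -- it equals `Y (0, 0)` times the conjugate of `4 i s Y (0, 0)`.
    have hform : Complex.normSq (Y (0, 0)) * propagatingFactor p.1 p.2.1 = 0 := by
      rw [Complex.ext_iff] at e1 e2 e3
      simp at e1 e2 e3
      rw [Complex.normSq_apply]
      have h3 := e3.1
      have h4 := e3.2
      linear_combination (1 / 4 : ℝ) * ((Y (0, 0)).im * h3 - (Y (0, 0)).re * h4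
        + z₀.re * e1.2 - z₀.im * e1.1 + z₁.re * e2.2 - z₁.im * e2.1)
    have ha : Y (0, 0) = 0 :=
      Complex.normSq_eq_zero.mp ((mul_eq_zero.mp hform).resolve_right hs.ne')
    exact ⟨ha, by rw [e4, ha]⟩

/-! ### Guided modes -/

/-- The pairing of the vector of the two residuals with the coupling vector `(γ₀, γ₁)`;
`siteForm` is its pairing with the orthogonal vector `(γ₁, -γ₀)`. -/
noncomputable def residualPairing (M : Fin 2 → ℝ) (k γ₁ : ℝ) (p : ℝ × ℝ × ℝ) : ℝ :=
  p.2.2 * residual₀ M k γ₁ p + γ₁ * residual₁ M k γ₁ p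

/-- The quadratic form of the site operator at the coupling vector `(γ₀, γ₁)`. -/
noncomputable def couplingForm (M : Fin 2 → ℝ) (k γ₁ : ℝ) (p : ℝ × ℝ × ℝ) : ℝ :=
  p.2.2 ^ 2 * site₀₀ M k p + 2 * (p.2.2 * γ₁) * site₀₁ M k γ₁ p + γ₁ ^ 2 * site₁₁ M k γ₁ p

lemma residual₀_eq (M : Fin 2 → ℝ) (k γ₁ : ℝ) (p : ℝ × ℝ × ℝ) :
    residual₀ M k γ₁ p = site₀₀ M k p * γ₁ - site₀₁ M k γ₁ p * p.2.2 := by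
  simp only [residual₀, site₀₀, site₀₁, hopping, div_eq_mul_inv, mul_inv]
  ring

lemma residual₁_eq (M : Fin 2 → ℝ) (k γ₁ : ℝ) (p : ℝ × ℝ × ℝ) :
    residual₁ M k γ₁ p = site₀₁ M k γ₁ p * γ₁ - site₁₁ M k γ₁ p * p.2.2 := by
  simp only [residual₁, site₁₁, site₀₁, hopping, div_eq_mul_inv, mul_inv]
  ring

lemma siteForm_eq (M : Fin 2 → ℝ) (k γ₁ : ℝ) (p : ℝ × ℝ × ℝ) :
    siteForm M k γ₁ p = γ₁ * residual₀ M k γ₁ p - p.2.2 * residual₁ M k γ₁ p := by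
  rw [residual₀_eq, residual₁_eq, siteForm]
  ring

/-- The determinant of the site operator in the orthogonal basis `(γ₀, γ₁)`, `(γ₁, -γ₀)`. -/
lemma siteDet_identity (M : Fin 2 → ℝ) (k γ₁ : ℝ) (p : ℝ × ℝ × ℝ) :
    (p.2.2 ^ 2 + γ₁ ^ 2) ^ 2 * siteDet M k γ₁ p
      = couplingForm M k γ₁ p * siteForm M k γ₁ p - residualPairing M k γ₁ p ^ 2 := by
  rw [residualPairing, residual₀_eq, residual₁_eq, siteForm, siteDet, couplingForm]
  ring

lemma residuals_eq_zero_iff {M : Fin 2 → ℝ} {k γ₁ : ℝ} {p : ℝ × ℝ × ℝ}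
    (hγ : p.2.2 ^ 2 + γ₁ ^ 2 ≠ 0) :
    (residual₀ M k γ₁ p = 0 ∧ residual₁ M k γ₁ p = 0) ↔
      (siteForm M k γ₁ p = 0 ∧ siteDet M k γ₁ p = 0) := by
  have hid := siteDet_identity M k γ₁ p
  have hf := siteForm_eq M k γ₁ p
  constructor
  · rintro ⟨h0, h1⟩
    have hQ : siteForm M k γ₁ p = 0 := by rw [hf, h0, h1]; ring
    refine ⟨hQ, ?_⟩
    rw [hQ, residualPairing, h0, h1] at hid
    have : (p.2.2 ^ 2 + γ₁ ^ 2) ^ 2 * siteDet M k γ₁ p = 0 := by rw [hid]; ring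
    exact (mul_eq_zero.mp this).resolve_left (pow_ne_zero 2 hγ)
  · rintro ⟨hQ, hD⟩
    have hP : residualPairing M k γ₁ p = 0 := by
      rw [hQ, hD] at hid
      have : residualPairing M k γ₁ p ^ 2 = 0 := by linarith
      exact pow_eq_zero_iff (two_ne_zero) |>.mp this
    rw [residualPairing] at hP
    rw [hQ] at hf
    have h0 : (p.2.2 ^ 2 + γ₁ ^ 2) * residual₀ M k γ₁ p = 0 := by
      linear_combination p.2.2 * hP - γ₁ * hf
    have h1 : (p.2.2 ^ 2 + γ₁ ^ 2) * residual₁ M k γ₁ p = 0 := by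
      linear_combination γ₁ * hP + p.2.2 * hf
    exact ⟨(mul_eq_zero.mp h0).resolve_left hγ, (mul_eq_zero.mp h1).resolve_left hγ⟩

lemma siteDet_nonpos {M : Fin 2 → ℝ} {k γ₁ : ℝ} {p : ℝ × ℝ × ℝ}
    (hγ : p.2.2 ^ 2 + γ₁ ^ 2 ≠ 0) (hQ : siteForm M k γ₁ p = 0) : siteDet M k γ₁ p ≤ 0 := by
  have hid := siteDet_identity M k γ₁ p
  rw [hQ, mul_zero, zero_sub] at hid
  have hpos : 0 < (p.2.2 ^ 2 + γ₁ ^ 2) ^ 2 := by positivity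
  by_contra h
  have := mul_pos hpos (not_le.mp h)
  nlinarith [sq_nonneg (residualPairing M k γ₁ p)]

lemma characteristic_eq_zero_iff {M : Fin 2 → ℝ} {k γ₁ : ℝ} {p : ℝ × ℝ × ℝ}
    (h₀ : |cosTheta p.1 p.2.1 0| < 1) :
    characteristic M k γ₁ p = 0 ↔ (siteForm M k γ₁ p = 0 ∧ siteDet M k γ₁ p = 0) := by
  have hs := (propagatingFactor_pos h₀).ne'
  rw [characteristic, Complex.ext_iff]
  simp [hs]

/-! ### The vanishing eigenvalue -/

lemma continuousAt_charpoly_coeff {E ι : Type} [TopologicalSpace E] [Fintype ι] [DecidableEq ι]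
    {B : E → Matrix ι ι ℂ} {q : E} (hB : ∀ i j, ContinuousAt (fun p => B p i j) q) (n : ℕ) :
    ContinuousAt (fun p => (B p).charpoly.coeff n) q := by
  have h : (fun p => (B p).charpoly.coeff n) = fun p =>
      MvPolynomial.eval (fun ij : ι × ι => B p ij.1 ij.2)
        ((Matrix.charpoly.univ ℂ ι).coeff n) := by
    ext p
    exact (Matrix.charpoly.univ_coeff_eval₂Hom (n := ι) (RingHom.id ℂ)
      (fun ij : ι × ι => B p ij.1 ij.2) n).symm
  rw [h]
  exact (MvPolynomial.continuous_eval _).continuousAt.comp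
    (f := fun p => fun ij : ι × ι => B p ij.1 ij.2) (continuousAt_pi.mpr fun ij => hB ij.1 ij.2)

/-- Near a point where zero is a simple eigenvalue, the eigenvalue branch through zero equals the
determinant up to a continuous nonvanishing factor. -/
lemma IsZeroEigenvalueBranch.exists_eq_mul_det {ι : Type} [Fintype ι] [DecidableEq ι]
    {B : ℝ × ℝ × ℝ → Matrix ι ι ℂ} {ev : ℝ × ℝ × ℝ → ℂ} {q : ℝ × ℝ × ℝ}
    (h : IsZeroEigenvalueBranch B ev q) (hB : ∀ i j, ContinuousAt (fun p => B p i j) q) :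
    ∃ v : ℝ × ℝ × ℝ → ℂ, ContinuousAt v q ∧ v q ≠ 0 ∧ ∀ᶠ p in 𝓝 q, ev p = v p * (B p).det := by
  set N : ℝ × ℝ × ℝ → ℂ := fun p =>
    ∑ i ∈ Finset.range (Fintype.card ι), (B p).charpoly.coeff (i + 1) * ev p ^ i with hN
  have hNc : ContinuousAt N q := by
    refine tendsto_finsetSum _ fun i _ => ?_
    exact (continuousAt_charpoly_coeff hB (i + 1)).mul (h.analyticAt.continuousAt.pow i)
  have hsplit : ∀ p, (B p).charpoly.eval (ev p) = N p * ev p + (B p).charpoly.coeff 0 := by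
    intro p
    rw [Polynomial.eval_eq_sum_range' (n := Fintype.card ι + 1)
      (by rw [Matrix.charpoly_natDegree_eq_dim]; exact Nat.lt_succ_self _),
      Finset.sum_range_succ', hN, Finset.sum_mul]
    simp [pow_succ, mul_assoc]
  have hroot : ∀ p, ev p ∈ spectrum ℂ (B p) → N p * ev p = -(B p).charpoly.coeff 0 := by
    intro p hp
    have := (Matrix.mem_spectrum_iff_isRoot_charpoly.mp hp).eq_zero
    rw [hsplit] at this
    linear_combination this
  have hNq : N q ≠ 0 := by
    intro h0
    have hc0 : (B q).charpoly.coeff 0 = 0 := by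
      have := hroot q h.mem_spectrum.self_of_nhds
      rw [h.eq_zero, mul_zero] at this
      linear_combination this
    have hcard : 0 < Fintype.card ι := by
      have hne : (B q).charpoly.natDegree ≠ 0 := by
        intro hdeg
        have hone : (B q).charpoly = 1 :=
          (Polynomial.Monic.natDegree_eq_zero (B q).charpoly_monic).mp hdeg
        rw [hone] at hc0
        simp at hc0
      rw [Matrix.charpoly_natDegree_eq_dim] at hne
      exact Nat.pos_of_ne_zero hne
    have hc1 : (B q).charpoly.coeff 1 = 0 := by
      rw [← h0, hN]
      simp only [h.eq_zero]
      rw [Finset.sum_eq_single_of_mem 0 (Finset.mem_range.mpr hcard)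
        (fun i _ hi => by simp [hi])]
      simp
    have hdvd : (Polynomial.X - Polynomial.C (0 : ℂ)) ^ 2 ∣ (B q).charpoly := by
      rw [Polynomial.C_0, sub_zero, Polynomial.X_pow_dvd_iff]
      intro d hd
      interval_cases d
      · exact hc0
      · exact hc1
    have := (Polynomial.le_rootMultiplicity_iff (B q).charpoly_monic.ne_zero).mpr hdvd
    rw [h.simple] at this
    omega
  refine ⟨fun p => -(-1) ^ Fintype.card ι * (N p)⁻¹, continuousAt_const.mul (hNc.inv₀ hNq),
    by simp [hNq], ?_⟩
  filter_upwards [h.mem_spectrum, hNc.eventually_ne hNq] with p hp hNp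
  have hr := hroot p hp
  have hsq : ((-1 : ℂ) ^ Fintype.card ι) * (-1) ^ Fintype.card ι = 1 := by
    rw [← mul_pow]
    simp
  rw [Matrix.det_eq_sign_charpoly_coeff]
  field_simp
  linear_combination hr + (B p).charpoly.coeff 0 * hsq

lemma continuousAt_step {ωs γs : ℝ} (h : OnePropagating 0 ωs) (l : Fin 2) :
    ContinuousAt (fun p : ℝ × ℝ × ℝ => step p.1 p.2.1 l) (0, ωs, γs) := by
  have hreg := eventually_regime (γs := γs) h
  fin_cases l
  · have heq : (fun p : ℝ × ℝ × ℝ => Complex.exp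
        ((Real.arccos (cosTheta p.1 p.2.1 0) : ℝ) * Complex.I)) =ᶠ[𝓝 (0, ωs, γs)]
        fun p => step p.1 p.2.1 0 :=
      hreg.mono fun p hp => (step_zero_of_propagating hp.1).symm
    refine ContinuousAt.congr ?_ heq
    have := Real.continuous_arccos.comp (continuous_cosTheta 0)
    exact (Complex.continuous_exp.comp
      ((Complex.continuous_ofReal.comp this).mul continuous_const)).continuousAt
  · have heq : (fun p : ℝ × ℝ × ℝ => Complex.exp
        ((-Real.arcosh (cosTheta p.1 p.2.1 1) : ℝ))) =ᶠ[𝓝 (0, ωs, γs)]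
        fun p => step p.1 p.2.1 1 :=
      hreg.mono fun p hp => (step_one_of_evanescent hp.2).symm
    refine ContinuousAt.congr ?_ heq
    have h1 := (Real.differentiableAt_arcosh hreg.self_of_nhds.2).continuousAt
    have h2 : ContinuousAt (fun p : ℝ × ℝ × ℝ => Real.arcosh (cosTheta p.1 p.2.1 1))
        (0, ωs, γs) :=
      ContinuousAt.comp (f := fun p : ℝ × ℝ × ℝ => cosTheta p.1 p.2.1 1) h1
        (continuous_cosTheta 1).continuousAt
    exact (Complex.continuous_exp.comp Complex.continuous_ofReal).continuousAt.comp
      (f := fun p : ℝ × ℝ × ℝ => -Real.arcosh (cosTheta p.1 p.2.1 1)) h2.neg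

lemma continuousAt_matB {M : Fin 2 → ℝ} {k γ₁ ωs γs : ℝ} {σ : Equiv.Perm (Fin 3 × Fin 2)}
    (h : OnePropagating 0 ωs) (i j : Fin 3 × Fin 2) :
    ContinuousAt (fun p => matB M k γ₁ σ p i j) (0, ωs, γs) := by
  have hγ : ∀ n : Fin 2, ContinuousAt
      (fun p : ℝ × ℝ × ℝ => (((![p.2.2, γ₁] : Fin 2 → ℝ) n : ℝ) : ℂ)) (0, ωs, γs) := by
    intro n
    apply Continuous.continuousAt
    fin_cases n
    · exact (Complex.continuous_ofReal.comp continuous_snd).comp continuous_snd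
    · exact (continuous_const : Continuous fun _ : ℝ × ℝ × ℝ => (γ₁ : ℂ))
  have hW : ∀ n l : Fin 2, ContinuousAt
      (fun p : ℝ × ℝ × ℝ => waveguideSymbol M (fun _ => k) p.1 p.2.1 n l) (0, ωs, γs) := by
    intro n l
    apply Continuous.continuousAt
    unfold waveguideSymbol phi
    fun_prop
  have hs := continuousAt_step (γs := γs) h
  simp only [matB, Matrix.submatrix_apply, id_eq, scatteringMatrix]
  refine ContinuousAt.mul ?_ continuousAt_const
  generalize σ i = r
  obtain ⟨r, n⟩ := r
  obtain ⟨c, l⟩ := j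
  fin_cases r <;> fin_cases c <;> simp
  · exact continuousAt_const
  · exact continuousAt_const
  · exact continuousAt_const
  · exact hs l
  · exact ((hs l).inv₀ (step_ne_zero _ _ l)).neg
  · exact (hγ n).neg
  · exact continuousAt_const
  · exact (hγ n).neg
  · exact hW n l

/-! ### Derivatives at a guided mode -/

lemma hasDerivAt_mul_of_eq_zero {A : Type} [NormedRing A] [NormedAlgebra ℝ A] {v f : ℝ → A}
    {f' : A} {t : ℝ} (hv : ContinuousAt v t) (hf : HasDerivAt f f' t) (h0 : f t = 0) :
    HasDerivAt (fun s => v s * f s) (v t * f') t := by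
  rw [hasDerivAt_iff_tendsto_slope] at hf ⊢
  refine ((hv.tendsto.mono_left nhdsWithin_le_nhds).mul hf).congr fun s => ?_
  simp [slope_def_module, h0]

/-- Comparison of the second-order terms of two products whose factors all vanish. -/
lemma deriv_mul_deriv_eq_of_mul_eq {f g h k : ℝ → ℂ} {f' g' h' k' : ℂ} {t : ℝ}
    (hf : HasDerivAt f f' t) (hg : HasDerivAt g g' t) (hh : HasDerivAt h h' t)
    (hk : HasDerivAt k k' t) (hf0 : f t = 0) (hg0 : g t = 0) (hh0 : h t = 0) (hk0 : k t = 0)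
    (heq : ∀ᶠ s in 𝓝 t, f s * g s = h s * k s) : f' * g' = h' * k' := by
  rw [hasDerivAt_iff_tendsto_slope] at hf hg hh hk
  refine tendsto_nhds_unique_of_eventuallyEq (hf.mul hg) (hh.mul hk) ?_
  filter_upwards [heq.filter_mono nhdsWithin_le_nhds] with s hs
  simp only [slope_def_module, hf0, hg0, hh0, hk0, sub_zero, smul_mul_smul_comm, hs]

section SiteFunctions

variable {M : Fin 2 → ℝ} {k γ₁ : ℝ} {q : ℝ × ℝ × ℝ}

lemma contDiffAt_evanescentFactor (h : 1 < cosTheta q.1 q.2.1 1) :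
    ContDiffAt ℝ ⊤ (fun p : ℝ × ℝ × ℝ => evanescentFactor p.1 p.2.1) q := by
  have hx : 2 - q.2.1 / 2 + Real.cos (Real.pi * q.1) = cosTheta q.1 q.2.1 1 := by
    rw [cosTheta, cos_two_pi_phi_one]
    ring
  have hne : (2 - q.2.1 / 2 + Real.cos (Real.pi * q.1)) ^ 2 - 1 ≠ 0 := by
    rw [hx]
    nlinarith
  unfold evanescentFactor
  refine contDiffAt_const.mul (ContDiffAt.sqrt ?_ hne)
  have hc : ContDiffAt ℝ ⊤ (fun p : ℝ × ℝ × ℝ => Real.cos (Real.pi * p.1)) q :=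
    (contDiffAt_const.mul contDiffAt_fst).cos
  fun_prop

lemma contDiffAt_site₀₀ (h : 1 < cosTheta q.1 q.2.1 1) :
    ContDiffAt ℝ ⊤ (site₀₀ M k) q := by
  have hd := contDiffAt_evanescentFactor h
  have hne : 2 * evanescentFactor q.1 q.2.1 ≠ 0 :=
    mul_ne_zero two_ne_zero (evanescentFactor_ne_zero h)
  unfold site₀₀
  exact ContDiffAt.sub (by fun_prop) (ContDiffAt.div (by fun_prop) (contDiffAt_const.mul hd) hne)

lemma contDiffAt_site₀₁ (h : 1 < cosTheta q.1 q.2.1 1) :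
    ContDiffAt ℝ ⊤ (site₀₁ M k γ₁) q := by
  have hd := contDiffAt_evanescentFactor h
  have hne : 2 * evanescentFactor q.1 q.2.1 ≠ 0 :=
    mul_ne_zero two_ne_zero (evanescentFactor_ne_zero h)
  have hc : ContDiffAt ℝ ⊤ (fun p : ℝ × ℝ × ℝ => Real.cos (Real.pi * p.1)) q :=
    (contDiffAt_const.mul contDiffAt_fst).cos
  unfold site₀₁ hopping
  exact ContDiffAt.add (by fun_prop) (ContDiffAt.div (by fun_prop) (contDiffAt_const.mul hd) hne)

lemma contDiffAt_site₁₁ (h : 1 < cosTheta q.1 q.2.1 1) :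
    ContDiffAt ℝ ⊤ (site₁₁ M k γ₁) q := by
  have hd := contDiffAt_evanescentFactor h
  have hne : 2 * evanescentFactor q.1 q.2.1 ≠ 0 :=
    mul_ne_zero two_ne_zero (evanescentFactor_ne_zero h)
  unfold site₁₁
  exact ContDiffAt.sub (by fun_prop) (ContDiffAt.div (by fun_prop) (contDiffAt_const.mul hd) hne)

lemma contDiffAt_siteDet (h : 1 < cosTheta q.1 q.2.1 1) :
    ContDiffAt ℝ ⊤ (siteDet M k γ₁) q :=
  ((contDiffAt_site₀₀ h).mul (contDiffAt_site₁₁ h)).sub ((contDiffAt_site₀₁ h).pow 2)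

lemma contDiffAt_residual₀ (h : 1 < cosTheta q.1 q.2.1 1) :
    ContDiffAt ℝ ⊤ (residual₀ M k γ₁) q := by
  have h00 : ContDiffAt ℝ ⊤ (site₀₀ M k) q := contDiffAt_site₀₀ h
  have h01 : ContDiffAt ℝ ⊤ (site₀₁ M k γ₁) q := contDiffAt_site₀₁ h
  rw [funext (residual₀_eq M k γ₁)]
  fun_prop

lemma contDiffAt_residual₁ (h : 1 < cosTheta q.1 q.2.1 1) :
    ContDiffAt ℝ ⊤ (residual₁ M k γ₁) q := by
  have h11 : ContDiffAt ℝ ⊤ (site₁₁ M k γ₁) q := contDiffAt_site₁₁ h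
  have h01 : ContDiffAt ℝ ⊤ (site₀₁ M k γ₁) q := contDiffAt_site₀₁ h
  rw [funext (residual₁_eq M k γ₁)]
  fun_prop

lemma contDiffAt_siteForm (h : 1 < cosTheta q.1 q.2.1 1) :
    ContDiffAt ℝ ⊤ (siteForm M k γ₁) q := by
  have h0 : ContDiffAt ℝ ⊤ (residual₀ M k γ₁) q := contDiffAt_residual₀ h
  have h1 : ContDiffAt ℝ ⊤ (residual₁ M k γ₁) q := contDiffAt_residual₁ h
  rw [funext (siteForm_eq M k γ₁)]
  fun_prop

lemma continuousAt_couplingForm (h : 1 < cosTheta q.1 q.2.1 1) :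
    ContinuousAt (couplingForm M k γ₁) q := by
  have h00 : ContinuousAt (site₀₀ M k) q := (contDiffAt_site₀₀ h).continuousAt
  have h01 : ContinuousAt (site₀₁ M k γ₁) q := (contDiffAt_site₀₁ h).continuousAt
  have h11 : ContinuousAt (site₁₁ M k γ₁) q := (contDiffAt_site₁₁ h).continuousAt
  unfold couplingForm
  fun_prop

lemma residual₀_neg (κ ω γ : ℝ) :
    residual₀ M k γ₁ (-κ, ω, γ) = residual₀ M k γ₁ (κ, ω, γ) := by
  simp only [residual₀, evanescentFactor, mul_neg, Real.cos_neg]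

lemma residual₁_neg (κ ω γ : ℝ) :
    residual₁ M k γ₁ (-κ, ω, γ) = residual₁ M k γ₁ (κ, ω, γ) := by
  simp only [residual₁, evanescentFactor, mul_neg, Real.cos_neg]

/-- At a guided mode the derivatives of `siteDet` and `siteForm` along every curve are
proportional. -/
lemma deriv_siteDet_eq {c : ℝ → ℝ × ℝ × ℝ} {t D' Q' : ℝ} (hc : DifferentiableAt ℝ c t)
    (h : 1 < cosTheta (c t).1 (c t).2.1 1) (h₀ : residual₀ M k γ₁ (c t) = 0)
    (h₁ : residual₁ M k γ₁ (c t) = 0) (hγ : (c t).2.2 ^ 2 + γ₁ ^ 2 ≠ 0)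
    (hD : HasDerivAt (fun s => siteDet M k γ₁ (c s)) D' t)
    (hQ : HasDerivAt (fun s => siteForm M k γ₁ (c s)) Q' t) :
    ((c t).2.2 ^ 2 + γ₁ ^ 2) ^ 2 * D' = couplingForm M k γ₁ (c t) * Q' := by
  obtain ⟨hQ0, hD0⟩ := (residuals_eq_zero_iff hγ).mp ⟨h₀, h₁⟩
  have hP0 : residualPairing M k γ₁ (c t) = 0 := by rw [residualPairing, h₀, h₁]; ring
  have hP : DifferentiableAt ℝ (fun s => residualPairing M k γ₁ (c s)) t := by
    have hd : DifferentiableAt ℝ (residualPairing M k γ₁) (c t) := by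
      have e0 : DifferentiableAt ℝ (residual₀ M k γ₁) (c t) :=
        (contDiffAt_residual₀ h).differentiableAt (by simp)
      have e1 : DifferentiableAt ℝ (residual₁ M k γ₁) (c t) :=
        (contDiffAt_residual₁ h).differentiableAt (by simp)
      unfold residualPairing
      fun_prop
    exact hd.comp t hc
  have hN : ContinuousAt (fun s => ((c s).2.2 ^ 2 + γ₁ ^ 2) ^ 2) t := by
    have := hc.continuousAt
    fun_prop
  have hT : ContinuousAt (fun s => couplingForm M k γ₁ (c s)) t :=
    (continuousAt_couplingForm h).comp hc.continuousAt
  have e1 := hasDerivAt_mul_of_eq_zero hN hD hD0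
  have e2 := (hasDerivAt_mul_of_eq_zero hT hQ hQ0).sub
    (hasDerivAt_mul_of_eq_zero hP.continuousAt hP.hasDerivAt hP0)
  have e3 := e1.unique (e2.congr_of_eventuallyEq (Eventually.of_forall fun s => by
    simp only [siteDet_identity, Pi.sub_apply, sq (residualPairing M k γ₁ (c s))]))
  rw [e3, hP0]
  ring

lemma hasDerivAt_characteristic {c : ℝ → ℝ × ℝ × ℝ} {t D' Q' : ℝ} (hc : ContinuousAt c t)
    (hD0 : siteDet M k γ₁ (c t) = 0)
    (hD : HasDerivAt (fun s => siteDet M k γ₁ (c s)) D' t)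
    (hQ : HasDerivAt (fun s => siteForm M k γ₁ (c s)) Q' t) :
    HasDerivAt (fun s => characteristic M k γ₁ (c s))
      (4 * Complex.I * propagatingFactor (c t).1 (c t).2.1 * D' - Q') t := by
  have hs : ContinuousAt
      (fun s => (4 * Complex.I * propagatingFactor (c s).1 (c s).2.1 : ℂ)) t := by
    have h1 : Continuous fun p : ℝ × ℝ × ℝ =>
        (4 * Complex.I * propagatingFactor p.1 p.2.1 : ℂ) :=
      continuous_const.mul (Complex.continuous_ofReal.comp
        ((continuous_const.sub ((continuous_cosTheta 0).pow 2)).sqrt))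
    exact h1.continuousAt.comp hc
  exact (hasDerivAt_mul_of_eq_zero hs hD.ofReal_comp (by simp [hD0])).sub hQ.ofReal_comp

/-- The derivatives of the real and imaginary parts of the eigenvalue are never independent at a
guided mode: both `∂ev/∂ω` and `∂ev/∂γ₀` are real multiples of the same complex number. -/
lemma jacobian_re_im_eq_zero {ev : ℝ × ℝ × ℝ → ℂ} {q : ℝ × ℝ × ℝ} {w : ℂ} {x y : ℝ}
    (hd : DifferentiableAt ℝ ev q) (hω : dOmega ev q = x * w) (hγ : dGamma ev q = y * w) :
    jacobian (fun p => (ev p).re) (fun p => (ev p).im) q = 0 := by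
  have h1 := hasDerivAt_dOmega hd
  have h2 := hasDerivAt_dGamma hd
  have r1 : dOmega (fun p => (ev p).re) q = (dOmega ev q).re :=
    (Complex.reCLM.hasFDerivAt.comp_hasDerivAt q.2.1 h1).deriv
  have r2 : dOmega (fun p => (ev p).im) q = (dOmega ev q).im :=
    (Complex.imCLM.hasFDerivAt.comp_hasDerivAt q.2.1 h1).deriv
  have r3 : dGamma (fun p => (ev p).re) q = (dGamma ev q).re :=
    (Complex.reCLM.hasFDerivAt.comp_hasDerivAt q.2.2 h2).deriv
  have r4 : dGamma (fun p => (ev p).im) q = (dGamma ev q).im :=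
    (Complex.imCLM.hasFDerivAt.comp_hasDerivAt q.2.2 h2).deriv
  rw [jacobian, r1, r2, r3, r4, hω, hγ]
  simp
  ring

end SiteFunctions

/-! ### The scattering problem near a guided mode -/

/-- The eigenvalue branch equals the characteristic function up to a continuous nonvanishing
factor. -/
lemma exists_eigenvalue_eq_mul_characteristic {M : Fin 2 → ℝ} {k γ₁ ωs γs : ℝ}
    {σ : Equiv.Perm (Fin 3 × Fin 2)} {ev : ℝ × ℝ × ℝ → ℂ} (hreg : OnePropagating 0 ωs)
    (hev : IsZeroEigenvalueBranch (matB M k γ₁ σ) ev (0, ωs, γs)) :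
    ∃ u : ℝ × ℝ × ℝ → ℂ, ContinuousAt u (0, ωs, γs) ∧ u (0, ωs, γs) ≠ 0 ∧
      ∀ᶠ p in 𝓝 (0, ωs, γs), ev p = u p * characteristic M k γ₁ p := by
  obtain ⟨v, hv, hv0, heq⟩ := hev.exists_eq_mul_det (continuousAt_matB hreg)
  have hr := eventually_regime (γs := γs) hreg
  have hd : ContinuousAt (fun p : ℝ × ℝ × ℝ => (evanescentFactor p.1 p.2.1 : ℂ)) (0, ωs, γs) :=
    Complex.continuous_ofReal.continuousAt.comp
      (f := fun p : ℝ × ℝ × ℝ => evanescentFactor p.1 p.2.1)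
      (contDiffAt_evanescentFactor hr.self_of_nhds.2).continuousAt
  refine ⟨fun p => v p * ((Equiv.Perm.sign σ : ℤ) * (-4 * (evanescentFactor p.1 p.2.1 : ℂ))),
    hv.mul (continuousAt_const.mul (continuousAt_const.mul hd)), ?_, ?_⟩
  · have h1 : (evanescentFactor 0 ωs : ℂ) ≠ 0 := by
      exact_mod_cast evanescentFactor_ne_zero hr.self_of_nhds.2
    have h2 : ((Equiv.Perm.sign σ : ℤ) : ℂ) ≠ 0 := by
      exact_mod_cast (Equiv.Perm.sign σ).ne_zero
    simp [hv0, h1, h2]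
  · filter_upwards [heq, hr] with p hp hrp
    rw [hp, matB, Matrix.det_permute, det_scatteringMatrix hrp.1 hrp.2]
    ring

end PeriodTwoLattice

open PeriodTwoLattice in
theorem mainTheorem1 (M : Fin 2 → ℝ) (hM : ∀ n, 0 < M n) (k γ₁ ωs γs : ℝ)
    (σ : Equiv.Perm (Fin 3 × Fin 2))
    (hreg : PeriodTwoLattice.OnePropagating 0 ωs)
    (ev : ℝ × ℝ × ℝ → ℂ)
    (hev : PeriodTwoLattice.IsZeroEigenvalueBranch (PeriodTwoLattice.matB M k γ₁ σ) ev (0, ωs, γs))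
    (c : ℂ) (hc : c ≠ 0) (X : ℝ × ℝ × ℝ → Fin 3 × Fin 2 → ℂ)
    (hX : PeriodTwoLattice.IsConnectingField (PeriodTwoLattice.matB M k γ₁ σ)
      (PeriodTwoLattice.vecF γ₁ σ) c ev X (0, ωs, γs))
    (a b : ℝ × ℝ × ℝ → ℂ) (ha : a = fun p => X p (0, 0)) (hb : b = fun p => X p (1, 0))
    (hev_ω : PeriodTwoLattice.dOmega ev (0, ωs, γs) ≠ 0)
    (ha_ω : PeriodTwoLattice.dOmega a (0, ωs, γs) ≠ 0)
    (hb_ω : PeriodTwoLattice.dOmega b (0, ωs, γs) ≠ 0)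
    (hdet : PeriodTwoLattice.jacobian (fun p => (ev p).re) (fun p => (ev p).im) (0, ωs, γs) ≠ 0 ∨
      PeriodTwoLattice.jacobian (PeriodTwoLattice.residual₀ M k γ₁)
        (PeriodTwoLattice.residual₁ M k γ₁) (0, ωs, γs) ≠ 0) :
    ∃ (δ j₁ j₂ v₁ v₂ : ℝ) (I J V : Set ℝ) (ωa ωb : ℝ → ℝ → ℝ) (g W : ℝ → ℝ),
      0 < δ ∧ I = Ioo (-δ) δ ∧ J = Ioo j₁ j₂ ∧ γs ∈ J ∧ V = Ioo v₁ v₂ ∧ ωs ∈ V ∧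
      ContDiffOn ℝ ((⊤ : ℕ∞) : WithTop ℕ∞) (fun x : ℝ × ℝ => ωa x.1 x.2) (I ×ˢ J) ∧
      ContDiffOn ℝ ((⊤ : ℕ∞) : WithTop ℕ∞) (fun x : ℝ × ℝ => ωb x.1 x.2) (I ×ˢ J) ∧
      ContDiffOn ℝ ((⊤ : ℕ∞) : WithTop ℕ∞) g I ∧ ContDiffOn ℝ ((⊤ : ℕ∞) : WithTop ℕ∞) W I ∧
      (∀ κ ∈ I, ∀ γ₀ ∈ J, ωa κ γ₀ ∈ V ∧ ωb κ γ₀ ∈ V ∧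
        a (κ, ωa κ γ₀, γ₀) = 0 ∧ b (κ, ωb κ γ₀, γ₀) = 0) ∧
      (∀ κ₀ ∈ I, g κ₀ ∈ J ∧ W κ₀ ∈ V ∧ ev (κ₀, W κ₀, g κ₀) = 0) ∧
      (∀ κ ∈ I, ∀ ω ∈ V, ∀ γ₀ ∈ J, ev (κ, ω, γ₀) = 0 ↔ ω = W κ ∧ γ₀ = g κ) ∧
      g 0 = γs ∧ W 0 = ωs ∧
      (deriv (deriv g) 0 < 0 → (∃ κ ∈ I, ωa κ γs < ωb κ γs) →
        PeriodTwoLattice.Bifurcates I J ωs γs ωa ωb g W (· < ·) (· < ·)) ∧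
      (deriv (deriv g) 0 < 0 → (∃ κ ∈ I, ωa κ γs > ωb κ γs) →
        PeriodTwoLattice.Bifurcates I J ωs γs ωa ωb g W (· > ·) (· < ·)) ∧
      (deriv (deriv g) 0 > 0 → (∃ κ ∈ I, ωa κ γs < ωb κ γs) →
        PeriodTwoLattice.Bifurcates I J ωs γs ωa ωb g W (· < ·) (· > ·)) ∧
      (deriv (deriv g) 0 > 0 → (∃ κ ∈ I, ωa κ γs > ωb κ γs) →
        PeriodTwoLattice.Bifurcates I J ωs γs ωa ωb g W (· > ·) (· > ·)) := by
  have hr := eventually_regime (γs := γs) hreg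
  obtain ⟨hr₀, hr₁⟩ := hr.self_of_nhds
  obtain ⟨u, hu, hu0, hueq⟩ := exists_eigenvalue_eq_mul_characteristic hreg hev
  have hχ0 : characteristic M k γ₁ (0, ωs, γs) = 0 := by
    have := hueq.self_of_nhds
    rw [hev.eq_zero] at this
    exact (mul_eq_zero.mp this.symm).resolve_left hu0
  obtain ⟨hQ0, hD0⟩ := (characteristic_eq_zero_iff hr₀).mp hχ0
  have hamp : ∀ᶠ p in 𝓝 (0, ωs, γs),
      characteristic M k γ₁ p * a p = siteForm M k γ₁ p * (c * ev p) ∧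
      characteristic M k γ₁ p * b p
        = 4 * Complex.I * propagatingFactor p.1 p.2.1 * siteDet M k γ₁ p * (c * ev p) ∧
      (c * ev p = 0 → a p = 0 ∧ b p = 0) := by
    rw [ha, hb]
    filter_upwards [hr, hX.solves] with p hp hXp
    exact amplitudes_of_solves hp.1 hp.2 hXp
  obtain ⟨ha0, hb0⟩ := hamp.self_of_nhds.2.2 (by rw [hev.eq_zero, mul_zero])
  have hda : DifferentiableAt ℝ a (0, ωs, γs) := by
    rw [ha]
    exact differentiableAt_pi.mp hX.analyticAt.differentiableAt (0, 0)
  have hdb : DifferentiableAt ℝ b (0, ωs, γs) := by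
    rw [hb]
    exact differentiableAt_pi.mp hX.analyticAt.differentiableAt (1, 0)
  have hdev : DifferentiableAt ℝ ev (0, ωs, γs) := hev.analyticAt.differentiableAt
  have hdD : DifferentiableAt ℝ (siteDet M k γ₁) (0, ωs, γs) :=
    (contDiffAt_siteDet hr₁).differentiableAt (by simp)
  have hdQ : DifferentiableAt ℝ (siteForm M k γ₁) (0, ωs, γs) :=
    (contDiffAt_siteForm hr₁).differentiableAt (by simp)
  have hlω : HasDerivAt (fun s : ℝ => ((0 : ℝ), s, γs)) (0, 1, 0) ωs :=
    (hasDerivAt_const _ _).prodMk ((hasDerivAt_id _).prodMk (hasDerivAt_const _ _))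
  have hlγ : HasDerivAt (fun s : ℝ => ((0 : ℝ), ωs, s)) (0, 0, 1) γs :=
    (hasDerivAt_const _ _).prodMk ((hasDerivAt_const _ _).prodMk (hasDerivAt_id _))
  have hχω := hasDerivAt_characteristic (M := M) (k := k) (γ₁ := γ₁) hlω.continuousAt hD0
    (hasDerivAt_dOmega hdD) (hasDerivAt_dOmega hdQ)
  have hχγ := hasDerivAt_characteristic (M := M) (k := k) (γ₁ := γ₁) hlγ.continuousAt hD0
    (hasDerivAt_dGamma hdD) (hasDerivAt_dGamma hdQ)
  dsimp only at hχω hχγ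
  have hevω : dOmega ev (0, ωs, γs) = u (0, ωs, γs) *
      (4 * Complex.I * propagatingFactor 0 ωs * dOmega (siteDet M k γ₁) (0, ωs, γs)
        - dOmega (siteForm M k γ₁) (0, ωs, γs)) :=
    (hasDerivAt_dOmega hdev).unique ((hasDerivAt_mul_of_eq_zero
      (v := fun s => u (0, s, γs))
      (hu.comp (f := fun s : ℝ => ((0 : ℝ), s, γs)) hlω.continuousAt) hχω hχ0).congr_of_eventuallyEq
      (hlω.continuousAt.eventually hueq))
  have hevγ : dGamma ev (0, ωs, γs) = u (0, ωs, γs) *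
      (4 * Complex.I * propagatingFactor 0 ωs * dGamma (siteDet M k γ₁) (0, ωs, γs)
        - dGamma (siteForm M k γ₁) (0, ωs, γs)) :=
    (hasDerivAt_dGamma hdev).unique ((hasDerivAt_mul_of_eq_zero
      (v := fun s => u (0, ωs, s))
      (hu.comp (f := fun s : ℝ => ((0 : ℝ), ωs, s)) hlγ.continuousAt) hχγ hχ0).congr_of_eventuallyEq
      (hlγ.continuousAt.eventually hueq))
  have hχω0 := right_ne_zero_of_mul (hevω ▸ hev_ω)
  have hLω : HasDerivAt (fun s => c * ev (0, s, γs)) (c * dOmega ev (0, ωs, γs)) ωs :=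
    (hasDerivAt_dOmega hdev).const_mul c
  have hL0 : c * ev (0, ωs, γs) = 0 := by rw [hev.eq_zero, mul_zero]
  -- The second `ω`-derivatives of the amplitude equations show that `∂ω a ≠ 0` and `∂ω b ≠ 0`
  -- pass to the real functions `siteForm` and `siteDet`.
  have hQω : dOmega (siteForm M k γ₁) (0, ωs, γs) ≠ 0 := by
    intro h
    have h2 := deriv_mul_deriv_eq_of_mul_eq hχω (hasDerivAt_dOmega hda)
      (hasDerivAt_dOmega hdQ).ofReal_comp hLω hχ0 ha0 (by simp [hQ0]) hL0
      (hlω.continuousAt.eventually (hamp.mono fun p hp => hp.1))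
    rw [h, Complex.ofReal_zero, zero_mul] at h2
    rw [h, Complex.ofReal_zero] at hχω0
    exact mul_ne_zero hχω0 ha_ω h2
  have hDω : dOmega (siteDet M k γ₁) (0, ωs, γs) ≠ 0 := by
    intro h
    have h2 := deriv_mul_deriv_eq_of_mul_eq hχω (hasDerivAt_dOmega hdb)
      (hχω.add (hasDerivAt_dOmega hdQ).ofReal_comp) hLω hχ0 hb0 (by simp [hQ0, hχ0]) hL0
      (by
        filter_upwards [hlω.continuousAt.eventually hamp] with s hs
        simpa [characteristic] using hs.2.1)
    rw [h, Complex.ofReal_zero, mul_zero, zero_sub, neg_add_cancel, zero_mul] at h2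
    rw [h, Complex.ofReal_zero, mul_zero, zero_sub] at hχω0
    exact mul_ne_zero hχω0 hb_ω h2
  have hγ0 : γs ^ 2 + γ₁ ^ 2 ≠ 0 := by
    intro h
    have h1 : γs = 0 := by nlinarith [sq_nonneg γs, sq_nonneg γ₁]
    have h2 : γ₁ = 0 := by nlinarith [sq_nonneg γs, sq_nonneg γ₁]
    apply hQω
    simp [dOmega, siteForm, h1, h2]
  obtain ⟨hE₀, hE₁⟩ :=
    (residuals_eq_zero_iff (p := ((0, ωs, γs) : ℝ × ℝ × ℝ)) hγ0).mpr ⟨hQ0, hD0⟩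
  have hj : jacobian (residual₀ M k γ₁) (residual₁ M k γ₁) (0, ωs, γs) ≠ 0 := by
    -- The first of the two alternatives never holds, so only the residuals can be nondegenerate.
    refine hdet.resolve_left fun h => h ?_
    have hω' := deriv_siteDet_eq hlω.differentiableAt hr₁ hE₀ hE₁ hγ0
      (hasDerivAt_dOmega hdD) (hasDerivAt_dOmega hdQ)
    have hγ' := deriv_siteDet_eq hlγ.differentiableAt hr₁ hE₀ hE₁ hγ0
      (hasDerivAt_dGamma hdD) (hasDerivAt_dGamma hdQ)
    dsimp only at hω' hγ'
    have hN : (γs ^ 2 + γ₁ ^ 2) ^ 2 ≠ 0 := pow_ne_zero 2 hγ0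
    rw [mul_comm, ← eq_div_iff hN, mul_comm, mul_div_assoc] at hω' hγ'
    refine jacobian_re_im_eq_zero hdev (w := u (0, ωs, γs) *
      (4 * Complex.I * propagatingFactor 0 ωs *
        (couplingForm M k γ₁ (0, ωs, γs) / (γs ^ 2 + γ₁ ^ 2) ^ 2 : ℝ) - 1))
      (x := dOmega (siteForm M k γ₁) (0, ωs, γs)) (y := dGamma (siteForm M k γ₁) (0, ωs, γs)) ?_ ?_
    · rw [hevω, hω']
      push_cast
      ring
    · rw [hevγ, hγ']
      push_cast
      ring
  have hγev : ∀ᶠ p : ℝ × ℝ × ℝ in 𝓝 (0, ωs, γs), p.2.2 ^ 2 + γ₁ ^ 2 ≠ 0 := by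
    have hc : ContinuousAt (fun p : ℝ × ℝ × ℝ => p.2.2 ^ 2 + γ₁ ^ 2) (0, ωs, γs) := by fun_prop
    exact hc.eventually_ne hγ0
  refine exists_bifurcation (contDiffAt_residual₀ hr₁) (contDiffAt_residual₁ hr₁)
    (contDiffAt_siteForm hr₁) (contDiffAt_siteDet hr₁) hE₀ hE₁ hj hQω hDω residual₀_neg
    residual₁_neg (hγev.mono fun p hp => residuals_eq_zero_iff hp)
    (hγev.mono fun p hp => siteDet_nonpos hp) ?_ ?_ ?_
  · filter_upwards [hr, hγev, hueq, hu.eventually_ne hu0] with p hp hγp hup hup0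
    rw [residuals_eq_zero_iff hγp, ← characteristic_eq_zero_iff hp.1, hup, mul_eq_zero,
      or_iff_right hup0]
  · filter_upwards [hamp, hueq] with p hp hup hQ
    by_cases hχ : characteristic M k γ₁ p = 0
    · exact (hp.2.2 (by rw [hup, hχ, mul_zero, mul_zero])).1
    · have := hp.1
      rw [hQ, Complex.ofReal_zero, zero_mul] at this
      exact (mul_eq_zero.mp this).resolve_left hχ
  · filter_upwards [hamp, hueq] with p hp hup hD
    by_cases hχ : characteristic M k γ₁ p = 0
    · exact (hp.2.2 (by rw [hup, hχ, mul_zero, mul_zero])).2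
    · have := hp.2.1
      rw [hD, Complex.ofReal_zero, mul_zero, zero_mul] at this
      exact (mul_eq_zero.mp this).resolve_left hχ
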